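/- **Theorem.** There is an absolute constant $c>0$ such that the following holds for all integers $n\ge 3$ and all $\varepsilon\in(0,1)$. Let $\mathcal A$ be any (possibly randomized) algorithm that receives $m$ i.i.d. samples from an unknown distribution $P$ on $\mathbb R^n$ and outputs a graph on the vertex set $[n]$. Suppose that for every zero-mean tree-structured Gaussian distribution $P$ on $\mathbb R^n$ the output of $\mathcal A$ is, with probability at least $9/10$, an $\frac{\varepsilon}{320}$-approximate tree for $P$. Then $m\ge c\,n/\varepsilon$; that is, $\Omega(n/\varepsilon)$ samples are necessary. Here, for a tree $T$ on $[n]$, a probability distribution $Q$ of $X=(X_1,\dots,X_n)$ on $\mathbb R^n$ that has a density is called *$T$-structured* if, for a rooted orientation of $T$, every non-root variable $X_i$ is conditionally independent of $\{X_j: j \text{ not reachable from } i\}$ given its parent $X_{pa(i)}$, and the density factorizes as $q(x)=q_r(x_r)\prod_{i\ne r} q(x_i\mid x_{pa(i)})$, where $r$ is the root. A distribution is *tree-structured* if it is $T$-structured for some tree $T$ on $[n]$. A tree $T$ is *$\eta$-approximate* for $P$ if there is a $T$-structured distribution $Q_T$ with $$D_{\mathrm{KL}}(P\|Q_T)\le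 \eta+\inf_{T'}\ \inf_{Q'\ T'\text{-structured}} D_{\mathrm{KL}}(P\|Q'),$$ where $T'$ ranges over all trees on $[n]$. -/

import Mathlib

open MeasureTheory ProbabilityTheory
open scoped ENNReal

namespace GaussianTree

noncomputable section

variable {n : ℕ}

/-- `p` is the parent of `i` when the edges of the tree `T` are oriented away from the root `r`:
the neighbour of `i` that is one step closer to `r`. The root has no parent. -/
def IsParent (T : SimpleGraph (Fin n)) (r p i : Fin n) : Prop :=
  T.Adj p i ∧ T.dist r i = T.dist r p + 1

/-- The set `nd(i)` of the vertices that are not reachable from `i` along the edges of `T` oriented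
away from the root `r` (every vertex is reachable from itself). -/
def nonDesc (T : SimpleGraph (Fin n)) (r i : Fin n) : Set (Fin n) :=
  {j | ¬ Relation.ReflTransGen (IsParent T r) i j}

/-- The density of the coordinate `X_i` under `Q`. -/
def dens (Q : Measure (Fin n → ℝ)) (i : Fin n) : ℝ → ℝ≥0∞ :=
  pdf (fun x : Fin n → ℝ => x i) Q

/-- The conditional density `Q[X_i = b ∣ X_p = a]`, the quotient of the density of `(X_p, X_i)` at
`(a, b)` by the density of `X_p` at `a`. -/
def condDens (Q : Measure (Fin n → ℝ)) (i p : Fin n) (b a : ℝ) : ℝ≥0∞ :=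
  pdf (fun x : Fin n → ℝ => (x p, x i)) Q volume (a, b) / dens Q p a

/-- Every `X_i` other than the root is conditionally independent of `(X_j)_{j ∈ nd(i)}` given its
parent. (For the root, `nd` is empty and there is nothing to require.) -/
def LocalMarkov (T : SimpleGraph (Fin n)) (r : Fin n) (Q : Measure (Fin n → ℝ))
    [IsProbabilityMeasure Q] : Prop :=
  ∀ i p : Fin n, IsParent T r p i →
    CondIndepFun
      (MeasurableSpace.comap (fun x : Fin n → ℝ => x p) inferInstance)
      (Measurable.comap_le (measurable_pi_apply p))
      (fun x : Fin n → ℝ => x i)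
      (fun (x : Fin n → ℝ) (j : nonDesc T r i) => x j) Q

open Classical in
/-- The joint density is the density of the root times, for each other vertex, its conditional
density given its parent. (In a tree the inner product has exactly one factor for each vertex
other than the root, and none for the root.) -/
def Factorizes (T : SimpleGraph (Fin n)) (r : Fin n) (Q : Measure (Fin n → ℝ)) : Prop :=
  Q.rnDeriv volume =ᵐ[volume] fun x =>
    dens Q r (x r) * ∏ i : Fin n, ∏ p : Fin n with IsParent T r p i, condDens Q i p (x i) (x p)

/-- `Q` is a `T`-structured distribution on `ℝⁿ`: `T` is a tree, `Q` has a density, and for a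
rooted orientation of `T` the distribution is Markov and its density factorizes. -/
structure IsTreeStructuredBy (T : SimpleGraph (Fin n)) (Q : Measure (Fin n → ℝ))
    [IsProbabilityMeasure Q] : Prop where
  isTree : T.IsTree
  hasDensity : Q ≪ volume
  markov : ∃ r : Fin n, LocalMarkov T r Q ∧ Factorizes T r Q

/-- `Q` is tree-structured. -/
def IsTreeStructured (Q : Measure (Fin n → ℝ)) [IsProbabilityMeasure Q] : Prop :=
  ∃ T : SimpleGraph (Fin n), IsTreeStructuredBy T Q

/-- The smallest divergence `D_KL(P ‖ Q')` over all trees `T'` and all `T'`-structured `Q'`. -/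
def optDiv (P : Measure (Fin n → ℝ)) : ℝ≥0∞ :=
  ⨅ (T : SimpleGraph (Fin n)) (Q : Measure (Fin n → ℝ)) (_ : IsProbabilityMeasure Q)
    (_ : IsTreeStructuredBy T Q), InformationTheory.klDiv P Q

/-- `T` is an `ε`-approximate tree for `P`. -/
def IsApproxTree (ε : ℝ) (P : Measure (Fin n → ℝ)) (T : SimpleGraph (Fin n)) : Prop :=
  T.IsTree ∧ ∃ (Q : Measure (Fin n → ℝ)) (_ : IsProbabilityMeasure Q),
    IsTreeStructuredBy T Q ∧ InformationTheory.klDiv P Q ≤ ENNReal.ofReal ε + optDiv P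

/-- All sets of graphs on the finite vertex set `Fin n` are measurable. -/
instance instMeasurableSpaceGraph : MeasurableSpace (SimpleGraph (Fin n)) := ⊤

/-- A (possibly randomized) algorithm that reads `m` samples in `ℝⁿ` and outputs a graph: the law
of its output given the samples. -/
abbrev Algorithm (n m : ℕ) : Type :=
  Kernel (Fin m → Fin n → ℝ) (SimpleGraph (Fin n))

/-- The law of the output of `A` when its `m` samples are drawn independently from `P`. -/
def outputLaw {m : ℕ} (A : Algorithm n m) (P : Measure (Fin n → ℝ)) :
    Measure (SimpleGraph (Fin n)) :=
  (Measure.pi fun _ : Fin m => P).bind A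

/-- For every zero-mean tree-structured Gaussian `P` on `ℝⁿ`, the algorithm outputs an
`ε`-approximate tree for `P` with probability at least `9/10`. Being tree-structured, `P` has a
density, that is, its covariance matrix is positive definite. -/
def LearnsTrees {m : ℕ} (A : Algorithm n m) (ε : ℝ) : Prop :=
  ∀ (P : Measure (Fin n → ℝ)) [IsGaussian P], (∀ i, ∫ x, x i ∂P = 0) → IsTreeStructured P →
    9 / 10 ≤ outputLaw A P {T | IsApproxTree ε P T}

end

end GaussianTree

/-!
The lower bound is witnessed by a family of very simple tree-structured Gaussians. Cut the vertices
into `K = n / 3` blocks of three, choose one edge of the triangle on each block, and let `P` be the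
centred Gaussian law with unit variances in which the two ends of every chosen edge have correlation
`θ`, where `θ ^ 2 = ε / (16 * K)`, and all other pairs are independent. The chosen edges form a
matching, so `P` is structured by any tree that contains them, and its optimal divergence is `0`
(`isTreeStructuredBy_matchedGaussian`, for a spider of depth two).

*Wrong edges are expensive.* If `T` misses `w` edges of the matching, every `T`-structured `Q`
satisfies `D(P ‖ Q) ≥ w * I`, where `I = -log (1 - θ ^ 2) / 2 ≥ θ ^ 2 / 2` is the mutual information
of a correlated pair (`ofReal_le_klDiv`). Nothing is assumed on the shape of the conditional
densities of `Q`: dividing each factor of the density of `Q` by the corresponding conditional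
density under `P` gives a ratio of `P`-expectation at most one, since `P` makes all edges of `T`
either a matched pair or an independent pair, and `log t ≤ t - 1` removes these ratios from
`E_P log (dP / dQ)`. What remains is the log-likelihood ratio of the missing edges. Hence an
`ε / 320`-approximate tree misses at most `K / 10` of the chosen edges.

*Wrong edges are unavoidable.* Erasing the edge of one block changes the law of `m` samples by a
likelihood ratio with second moment `(1 - θ ^ 2)⁻¹ ^ m`, which is close to one when `m` is much
smaller than `n / ε`; so the output can hardly depend on that edge (`outputLaw_sub_le`). But the
output is a tree and contains at most two of the three candidate edges of a block. Averaging over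
all choices of edges (`not_learnsTrees`), at least a quarter of the chosen edges is missed on
average, while success with probability `9 / 10` allows only a fifth.
-/

namespace GaussianTree

variable {n : ℕ}

/-! ### Correlated pairs of standard Gaussians -/

/-- The standard Gaussian measure on `ℝ`. -/
noncomputable abbrev stdNormal : Measure ℝ := gaussianReal 0 1

/-- The density, with respect to the product of two standard Gaussians, of a centred Gaussian pair
with unit variances and correlation `θ`. -/
noncomputable def corrDensity (θ x y : ℝ) : ℝ :=
  (√(1 - θ ^ 2))⁻¹ * Real.exp (-(θ ^ 2 * x ^ 2 - 2 * θ * x * y + θ ^ 2 * y ^ 2) / (2 * (1 - θ ^ 2)))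

lemma corrDensity_zero (x y : ℝ) : corrDensity 0 x y = 1 := by
  simp [corrDensity]

lemma corrDensity_pos {θ : ℝ} (hθ : θ ^ 2 < 1) (x y : ℝ) : 0 < corrDensity θ x y := by
  have : 0 < √(1 - θ ^ 2) := Real.sqrt_pos.2 (by linarith)
  unfold corrDensity
  positivity

lemma corrDensity_swap (θ x y : ℝ) : corrDensity θ x y = corrDensity θ y x := by
  unfold corrDensity
  congr 3
  ring

@[fun_prop]
lemma measurable_corrDensity {α : Type*} [MeasurableSpace α] (θ : ℝ) {f g : α → ℝ}
    (hf : Measurable f) (hg : Measurable g) : Measurable fun a => corrDensity θ (f a) (g a) := by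
  unfold corrDensity
  fun_prop

lemma log_corrDensity {θ : ℝ} (hθ : θ ^ 2 < 1) (x y : ℝ) :
    Real.log (corrDensity θ x y) = -(Real.log (1 - θ ^ 2)) / 2
      - (θ ^ 2 * x ^ 2 - 2 * θ * x * y + θ ^ 2 * y ^ 2) / (2 * (1 - θ ^ 2)) := by
  have : 0 < √(1 - θ ^ 2) := Real.sqrt_pos.2 (by linarith)
  unfold corrDensity
  rw [Real.log_mul (by positivity) (by positivity), Real.log_exp, Real.log_inv,
    Real.log_sqrt (by linarith)]
  ring

/-- The conditional law of the second coordinate of a correlated pair is again Gaussian. -/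
lemma gaussianPDFReal_mul_corrDensity {θ : ℝ} (hθ : θ ^ 2 < 1) (a y : ℝ) :
    gaussianPDFReal 0 1 y * corrDensity θ a y
      = gaussianPDFReal (θ * a) (1 - θ ^ 2).toNNReal y := by
  have h1 : (0 : ℝ) < 1 - θ ^ 2 := by linarith
  have h2 : √(2 * Real.pi * (1 - θ ^ 2)) = √(2 * Real.pi) * √(1 - θ ^ 2) :=
    Real.sqrt_mul (by positivity) _
  simp only [gaussianPDFReal, corrDensity, NNReal.coe_one, mul_one, Real.coe_toNNReal _ h1.le, h2]
  rw [mul_mul_mul_comm, ← Real.exp_add, mul_inv]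
  congr 2
  field_simp
  ring

lemma gaussianPDF_mul_corrDensity {θ : ℝ} (hθ : θ ^ 2 < 1) (a y : ℝ) :
    gaussianPDF 0 1 y * ENNReal.ofReal (corrDensity θ a y)
      = gaussianPDF (θ * a) (1 - θ ^ 2).toNNReal y := by
  simp only [gaussianPDF]
  rw [← gaussianPDFReal_mul_corrDensity hθ,
    ENNReal.ofReal_mul (gaussianPDFReal_nonneg _ _ _)]

lemma lintegral_stdNormal {F : ℝ → ℝ≥0∞} (hF : Measurable F) :
    ∫⁻ y, F y ∂stdNormal = ∫⁻ y, gaussianPDF 0 1 y * F y := by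
  rw [stdNormal, gaussianReal_of_var_ne_zero _ one_ne_zero,
    lintegral_withDensity_eq_lintegral_mul _ (measurable_gaussianPDF _ _) hF]
  rfl

lemma lintegral_affine_stdNormal {θ : ℝ} (hθ : θ ^ 2 < 1) (a : ℝ) {F : ℝ → ℝ≥0∞}
    (hF : Measurable F) :
    ∫⁻ y, F (θ * a + √(1 - θ ^ 2) * y) ∂stdNormal
      = ∫⁻ y, F y * ENNReal.ofReal (corrDensity θ a y) ∂stdNormal := by
  have h1 : (0 : ℝ) < 1 - θ ^ 2 := by linarith
  have hs : (1 - θ ^ 2).toNNReal ≠ 0 := by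
    simpa using hθ
  have key : stdNormal.map (fun y => θ * a + √(1 - θ ^ 2) * y)
      = gaussianReal (θ * a) (1 - θ ^ 2).toNNReal := by
    have : (fun y => θ * a + √(1 - θ ^ 2) * y) = (fun y => θ * a + y) ∘ (√(1 - θ ^ 2) * ·) := rfl
    rw [this, ← Measure.map_map (by fun_prop) (by fun_prop), gaussianReal_map_const_mul,
      gaussianReal_map_const_add]
    congr 1
    · ring
    · ext
      rw [Real.coe_toNNReal _ h1.le]
      simp [Real.sq_sqrt h1.le]
  rw [← lintegral_map hF (by fun_prop), key, gaussianReal_of_var_ne_zero _ hs,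
    lintegral_withDensity_eq_lintegral_mul _ (measurable_gaussianPDF _ _) hF,
    lintegral_stdNormal (by fun_prop)]
  refine lintegral_congr fun y => ?_
  rw [Pi.mul_apply, ← gaussianPDF_mul_corrDensity hθ]
  ring

lemma lintegral_corrDensity_right {θ : ℝ} (hθ : θ ^ 2 < 1) (a : ℝ) :
    ∫⁻ y, ENNReal.ofReal (corrDensity θ a y) ∂stdNormal = 1 := by
  simpa using (lintegral_affine_stdNormal hθ a (F := fun _ => 1) measurable_const).symm

/-- Both coordinates of a correlated pair are standard Gaussian. -/
lemma lintegral_corrPair_snd {θ : ℝ} (hθ : θ ^ 2 < 1) {F : ℝ → ℝ≥0∞} (hF : Measurable F) :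
    ∫⁻ x, ∫⁻ y, F (θ * x + √(1 - θ ^ 2) * y) ∂stdNormal ∂stdNormal = ∫⁻ y, F y ∂stdNormal := by
  simp_rw [lintegral_affine_stdNormal hθ _ hF]
  rw [lintegral_lintegral_swap (by fun_prop)]
  refine lintegral_congr fun y => ?_
  rw [lintegral_const_mul _ (by fun_prop)]
  simp_rw [corrDensity_swap θ _ y]
  rw [lintegral_corrDensity_right hθ, mul_one]

/-- The second moment of the likelihood ratio of a correlated pair against an independent one. -/
lemma lintegral_corrDensity_sq {θ : ℝ} (hθ : θ ^ 2 < 1) :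
    ∫⁻ x, ∫⁻ y, ENNReal.ofReal (corrDensity θ x y ^ 2) ∂stdNormal ∂stdNormal
      = ENNReal.ofReal (1 - θ ^ 2)⁻¹ := by
  have h1 : (0 : ℝ) < 1 - θ ^ 2 := by linarith
  have h3 : (0 : ℝ) < 1 + θ ^ 2 := by positivity
  obtain ⟨v, hv'⟩ : ∃ v : NNReal, (v : ℝ) = (1 - θ ^ 2) / (1 + θ ^ 2) :=
    ⟨_, Real.coe_toNNReal _ (by positivity)⟩
  obtain ⟨w, hw'⟩ : ∃ w : NNReal, (w : ℝ) = (1 + θ ^ 2) / (1 - θ ^ 2) :=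
    ⟨_, Real.coe_toNNReal _ (by positivity)⟩
  have hv : v ≠ 0 := by
    rw [← NNReal.coe_ne_zero, hv']
    positivity
  have hw : w ≠ 0 := by
    rw [← NNReal.coe_ne_zero, hw']
    positivity
  have hr : ∀ x y, gaussianPDFReal 0 1 x * gaussianPDFReal 0 1 y * corrDensity θ x y ^ 2
      = (1 - θ ^ 2)⁻¹ * gaussianPDFReal 0 w x
        * gaussianPDFReal (2 * θ * x / (1 + θ ^ 2)) v y := by
    intro x y
    have h4 : √(2 * Real.pi * v) * √(2 * Real.pi * w) = √(2 * Real.pi) * √(2 * Real.pi) := by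
      rw [← Real.sqrt_mul (by positivity), ← Real.sqrt_mul (by positivity)]
      congr 1
      rw [hv', hw']
      field_simp
    have h5 : (√(1 - θ ^ 2))⁻¹ ^ 2 = (1 - θ ^ 2)⁻¹ := by
      rw [inv_pow, Real.sq_sqrt h1.le]
    simp only [gaussianPDFReal, corrDensity, mul_pow, h5, NNReal.coe_one, mul_one]
    rw [← Real.exp_nat_mul]
    have e1 : ∀ A B C D E F G : ℝ, A⁻¹ * Real.exp B * (A⁻¹ * Real.exp C) * (D * Real.exp E)
        = D * (A * A)⁻¹ * Real.exp (B + C + E) := by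
      intros; rw [Real.exp_add, Real.exp_add, mul_inv]; ring
    have e2 : ∀ A A' B C D : ℝ, D * (A⁻¹ * Real.exp B) * (A'⁻¹ * Real.exp C)
        = D * (A' * A)⁻¹ * Real.exp (B + C) := by
      intros; rw [Real.exp_add, mul_inv]; ring
    rw [e1, e2, h4]
    · congr 2
      rw [hv', hw']
      field_simp
      ring
    all_goals exact 0
  have key : ∀ x, (∫⁻ y, ENNReal.ofReal (corrDensity θ x y ^ 2) ∂stdNormal) * gaussianPDF 0 1 x
      = ENNReal.ofReal (1 - θ ^ 2)⁻¹ * gaussianPDF 0 w x := by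
    intro x
    rw [lintegral_stdNormal (by fun_prop), ← lintegral_mul_const _ (by fun_prop)]
    calc _ = ∫⁻ y, ENNReal.ofReal (1 - θ ^ 2)⁻¹ * gaussianPDF 0 w x
          * gaussianPDF (2 * θ * x / (1 + θ ^ 2)) v y := by
          refine lintegral_congr fun y => ?_
          simp only [gaussianPDF]
          have h6 : (0 : ℝ) ≤ (1 - θ ^ 2)⁻¹ := by positivity
          rw [← ENNReal.ofReal_mul (gaussianPDFReal_nonneg _ _ _),
            ← ENNReal.ofReal_mul (mul_nonneg (gaussianPDFReal_nonneg _ _ _) (sq_nonneg _)),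
            ← ENNReal.ofReal_mul h6,
            ← ENNReal.ofReal_mul (mul_nonneg h6 (gaussianPDFReal_nonneg _ _ _)), ← hr]
          congr 1
          ring
      _ = _ := by
          rw [lintegral_const_mul _ (by fun_prop), lintegral_gaussianPDF_eq_one _ hv, mul_one]
  rw [lintegral_stdNormal (by fun_prop)]
  simp_rw [fun x => mul_comm (gaussianPDF 0 1 x), key]
  rw [lintegral_const_mul _ (by fun_prop), lintegral_gaussianPDF_eq_one _ hw, mul_one]

lemma integrable_sq_stdNormal : Integrable (fun x : ℝ => x ^ 2) stdNormal :=
  (memLp_id_gaussianReal 2).integrable_sq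

lemma integrable_id_stdNormal : Integrable (fun x : ℝ => x) stdNormal :=
  (memLp_id_gaussianReal 1).integrable le_rfl

/-- The log-likelihood ratio of a correlated pair, written in terms of the two independent
Gaussians that generate the pair. -/
lemma log_corrDensity_affine {θ : ℝ} (hθ : θ ^ 2 < 1) (x y : ℝ) :
    Real.log (corrDensity θ x (θ * x + √(1 - θ ^ 2) * y)) = -(Real.log (1 - θ ^ 2)) / 2
      + (θ ^ 2 / 2) * (x ^ 2 - y ^ 2) + θ * √(1 - θ ^ 2) * (x * y) := by
  have h1 : (0 : ℝ) < 1 - θ ^ 2 := by linarith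
  obtain ⟨s, hs⟩ : ∃ s, s = √(1 - θ ^ 2) := ⟨_, rfl⟩
  have h2 : s ^ 2 = 1 - θ ^ 2 := by rw [hs, Real.sq_sqrt h1.le]
  rw [log_corrDensity hθ, ← hs, sub_eq_add_neg, add_assoc, add_left_cancel_iff, ← neg_div,
    div_eq_iff (by positivity)]
  have h3 : (θ * x + s * y) ^ 2
      = θ ^ 2 * x ^ 2 + 2 * θ * s * (x * y) + (1 - θ ^ 2) * y ^ 2 := by
    rw [← h2]; ring
  rw [h3]
  ring

lemma integrable_log_corrDensity_affine {θ : ℝ} (hθ : θ ^ 2 < 1) :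
    Integrable (fun q : ℝ × ℝ => Real.log (corrDensity θ q.1 (θ * q.1 + √(1 - θ ^ 2) * q.2)))
      (stdNormal.prod stdNormal) := by
  simp_rw [log_corrDensity_affine hθ]
  refine ((integrable_const _).add (((integrable_sq_stdNormal.comp_fst _).sub
    (integrable_sq_stdNormal.comp_snd _)).const_mul _)).add
      ((integrable_id_stdNormal.mul_prod integrable_id_stdNormal).const_mul _)

/-- The mutual information of a Gaussian pair with correlation `θ`. -/
lemma integral_log_corrDensity_affine {θ : ℝ} (hθ : θ ^ 2 < 1) :
    ∫ q : ℝ × ℝ, Real.log (corrDensity θ q.1 (θ * q.1 + √(1 - θ ^ 2) * q.2))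
      ∂(stdNormal.prod stdNormal) = -(Real.log (1 - θ ^ 2)) / 2 := by
  simp_rw [log_corrDensity_affine hθ]
  have h1 := integrable_sq_stdNormal.comp_fst stdNormal
  have h2 := integrable_sq_stdNormal.comp_snd stdNormal
  have h3 := integrable_id_stdNormal.mul_prod integrable_id_stdNormal
  have h4 : Integrable (fun q : ℝ × ℝ => θ ^ 2 / 2 * (q.1 ^ 2 - q.2 ^ 2))
      (stdNormal.prod stdNormal) := (h1.sub h2).const_mul _
  have h5 : Integrable (fun q : ℝ × ℝ => -(Real.log (1 - θ ^ 2)) / 2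
      + θ ^ 2 / 2 * (q.1 ^ 2 - q.2 ^ 2)) (stdNormal.prod stdNormal) := (integrable_const _).add h4
  rw [integral_add h5 (h3.const_mul _),
    integral_add (integrable_const _) h4, integral_const_mul,
    integral_const_mul, integral_sub h1 h2, integral_prod_mul (fun x : ℝ => x) (fun y : ℝ => y),
    integral_fun_fst (fun x : ℝ => x ^ 2), integral_fun_snd (fun x : ℝ => x ^ 2),
    integral_id_gaussianReal]
  simp

/-! ### Gaussian vectors correlated along a matching -/

/-- The standard Gaussian measure on `ℝⁿ`. -/
noncomputable abbrev stdNormalPi (n : ℕ) : Measure (Fin n → ℝ) := Measure.pi fun _ => stdNormal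

/-- Replacing one coordinate of a standard Gaussian vector by an independent copy does not change
its law. -/
lemma lintegral_stdNormalPi_update (i : Fin n) {F : (Fin n → ℝ) → ℝ≥0∞} (hF : Measurable F) :
    ∫⁻ z, F z ∂stdNormalPi n
      = ∫⁻ z, ∫⁻ y, F (Function.update z i y) ∂stdNormal ∂stdNormalPi n := by
  have key : ((stdNormalPi n).prod stdNormal).map (fun q => Function.update q.1 i q.2)
      = stdNormalPi n := by
    refine (Measure.pi_eq fun s hs => ?_).symm
    rw [Measure.map_apply (by fun_prop) (MeasurableSet.univ_pi hs)]
    have : (fun q : (Fin n → ℝ) × ℝ => Function.update q.1 i q.2) ⁻¹' (Set.univ.pi s)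
        = (Set.univ.pi (Function.update s i Set.univ)) ×ˢ s i := by
      ext ⟨z, y⟩
      simp only [Set.mem_preimage, Set.mem_pi, Set.mem_univ, true_implies, Set.mem_prod]
      constructor
      · refine fun h => ⟨fun j => ?_, by simpa using h i⟩
        by_cases hj : j = i
        · subst hj; simp
        · simpa [hj] using h j
      · rintro ⟨h, h'⟩ j
        by_cases hj : j = i
        · subst hj; simpa using h'
        · simpa [hj] using h j
    rw [this, Measure.prod_prod, Measure.pi_pi, ← Finset.prod_erase_mul _ _ (Finset.mem_univ i),
      ← Finset.prod_erase_mul (Finset.univ) (fun j => stdNormal (s j)) (Finset.mem_univ i)]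
    simp only [Function.update_self, measure_univ, mul_one]
    congr 1
    refine Finset.prod_congr rfl fun j hj => ?_
    rw [Function.update_of_ne (Finset.ne_of_mem_erase hj)]
  conv_lhs => rw [← key]
  rw [lintegral_map hF (by fun_prop), lintegral_prod _ (by fun_prop)]

lemma lintegral_stdNormalPi_eval (i : Fin n) {F : ℝ → ℝ≥0∞} (hF : Measurable F) :
    ∫⁻ z, F (z i) ∂stdNormalPi n = ∫⁻ y, F y ∂stdNormal :=
  (measurePreserving_eval (fun _ : Fin n => stdNormal) i).lintegral_comp hF

instance isGaussian_stdNormalPi : IsGaussian (stdNormalPi n) := by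
  have h : iIndepFun (fun (i : Fin n) (z : Fin n → ℝ) => z i) (stdNormalPi n) :=
    iIndepFun_pi (X := fun _ (y : ℝ) => y) fun _ => aemeasurable_id
  have h' : ∀ i : Fin n, HasGaussianLaw (fun z : Fin n → ℝ => z i) (stdNormalPi n) := fun i =>
    ⟨by
      have : (stdNormalPi n).map (fun z => z i) = stdNormal :=
        (measurePreserving_eval (fun _ : Fin n => stdNormal) i).map_eq
      rw [this]
      infer_instance⟩
  have := (iIndepFun.hasGaussianLaw h' h).isGaussian_map
  simpa using this

/-- `par` encodes a matching whose edges are oriented: `par b = some a` says that `a` and `b` are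
matched, with `a` as the first vertex. -/
structure IsMatching (par : Fin n → Option (Fin n)) : Prop where
  par_eq_none : ∀ {b a}, par b = some a → par a = none
  inj : ∀ {b b' a}, par b = some a → par b' = some a → b = b'

/-- The linear map that gives every matched pair of coordinates correlation `θ`. -/
noncomputable def couple (θ : ℝ) (par : Fin n → Option (Fin n)) (z : Fin n → ℝ) (i : Fin n) : ℝ :=
  (par i).elim (z i) fun a => θ * z a + √(1 - θ ^ 2) * z i

lemma couple_none {θ : ℝ} {par : Fin n → Option (Fin n)} {i : Fin n} (h : par i = none)
    (z : Fin n → ℝ) : couple θ par z i = z i := by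
  simp [couple, h]

lemma couple_some {θ : ℝ} {par : Fin n → Option (Fin n)} {i a : Fin n} (h : par i = some a)
    (z : Fin n → ℝ) : couple θ par z i = θ * z a + √(1 - θ ^ 2) * z i := by
  simp [couple, h]

/-- `couple` as a continuous linear map. -/
noncomputable def coupleL (θ : ℝ) (par : Fin n → Option (Fin n)) :
    (Fin n → ℝ) →L[ℝ] (Fin n → ℝ) :=
  ContinuousLinearMap.pi fun i => (par i).elim (ContinuousLinearMap.proj i)
    fun a => θ • ContinuousLinearMap.proj a + √(1 - θ ^ 2) • ContinuousLinearMap.proj i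

lemma coupleL_apply (θ : ℝ) (par : Fin n → Option (Fin n)) (z : Fin n → ℝ) :
    coupleL θ par z = couple θ par z := by
  ext i
  rcases h : par i with _ | a <;> simp [coupleL, couple, h]

@[fun_prop]
lemma measurable_couple (θ : ℝ) (par : Fin n → Option (Fin n)) : Measurable (couple θ par) := by
  have : couple θ par = coupleL θ par := by ext1 z; rw [coupleL_apply]
  rw [this]
  fun_prop

/-- The centred Gaussian law on `ℝⁿ` with unit variances in which matched coordinates have
correlation `θ` and all other pairs are independent. -/
noncomputable def matchedGaussian (θ : ℝ) (par : Fin n → Option (Fin n)) : Measure (Fin n → ℝ) :=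
  (stdNormalPi n).map (couple θ par)

instance isGaussian_matchedGaussian (θ : ℝ) (par : Fin n → Option (Fin n)) :
    IsGaussian (matchedGaussian θ par) := by
  have : couple θ par = coupleL θ par := by ext1 z; rw [coupleL_apply]
  rw [matchedGaussian, this]
  infer_instance

lemma lintegral_matchedGaussian (θ : ℝ) (par : Fin n → Option (Fin n))
    {F : (Fin n → ℝ) → ℝ≥0∞} (hF : Measurable F) :
    ∫⁻ x, F x ∂matchedGaussian θ par = ∫⁻ z, F (couple θ par z) ∂stdNormalPi n :=
  lintegral_map hF (by fun_prop)

lemma integral_matchedGaussian_eval (θ : ℝ) (par : Fin n → Option (Fin n)) (i : Fin n) :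
    ∫ x, x i ∂matchedGaussian θ par = 0 := by
  have h0 : ∀ j : Fin n, ∫ z, z j ∂stdNormalPi n = 0 := fun j => by
    rw [integral_eval (μ := fun _ : Fin n => stdNormal), integral_id_gaussianReal]
  have h1 : ∀ j : Fin n, Integrable (fun z : Fin n → ℝ => z j) (stdNormalPi n) := fun j =>
    integrable_eval (μ := fun _ : Fin n => stdNormal) integrable_id_stdNormal
  have hm : AEStronglyMeasurable (fun x : Fin n → ℝ => x i)
      ((stdNormalPi n).map (couple θ par)) := (measurable_pi_apply i).aestronglyMeasurable
  rw [matchedGaussian, integral_map (by fun_prop) hm]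
  rcases h : par i with _ | a
  · simp_rw [couple_none h, h0]
  · simp_rw [couple_some h]
    rw [integral_add ((h1 a).const_mul _) ((h1 i).const_mul _), integral_const_mul,
      integral_const_mul, h0, h0]
    simp

lemma couple_update_of_ne {θ : ℝ} {par : Fin n → Option (Fin n)} {i j : Fin n} (hj : j ≠ i)
    (hp : par j ≠ some i) (z : Fin n → ℝ) (y : ℝ) :
    couple θ par (Function.update z i y) j = couple θ par z j := by
  rcases h : par j with _ | a
  · simp [couple_none h, hj]
  · have : a ≠ i := fun e => hp (e ▸ h)
    simp [couple_some h, hj, this]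

lemma couple_update_self_of_none {θ : ℝ} {par : Fin n → Option (Fin n)} {i : Fin n}
    (h : par i = none) (z : Fin n → ℝ) (y : ℝ) :
    couple θ par (Function.update z i y) i = y := by
  simp [couple_none h]

lemma IsMatching.ne_of_par_eq {par : Fin n → Option (Fin n)} (hM : IsMatching par) {b a : Fin n}
    (h : par b = some a) : a ≠ b := by
  rintro rfl
  simp [hM.par_eq_none h] at h

lemma couple_update_self_of_some {θ : ℝ} {par : Fin n → Option (Fin n)} (hM : IsMatching par)
    {i a : Fin n} (h : par i = some a) (z : Fin n → ℝ) (y : ℝ) :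
    couple θ par (Function.update z i y) i = θ * couple θ par z a + √(1 - θ ^ 2) * y := by
  simp [couple_some h, couple_none (hM.par_eq_none h), hM.ne_of_par_eq h]

/-- All coordinates of a matched Gaussian are standard Gaussian. -/
lemma lintegral_matchedGaussian_eval {θ : ℝ} (hθ : θ ^ 2 < 1) {par : Fin n → Option (Fin n)}
    (hM : IsMatching par) (i : Fin n) {F : ℝ → ℝ≥0∞} (hF : Measurable F) :
    ∫⁻ x, F (x i) ∂matchedGaussian θ par = ∫⁻ y, F y ∂stdNormal := by
  rw [lintegral_matchedGaussian _ _ (by fun_prop),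
    lintegral_stdNormalPi_update i (F := fun z => F (couple θ par z i)) (by fun_prop)]
  rcases h : par i with _ | a
  · simp_rw [couple_update_self_of_none h]
    simp
  · simp_rw [couple_update_self_of_some hM h, couple_none (hM.par_eq_none h)]
    rw [lintegral_stdNormalPi_eval a
      (F := fun x => ∫⁻ y, F (θ * x + √(1 - θ ^ 2) * y) ∂stdNormal) (by fun_prop),
      lintegral_corrPair_snd hθ hF]

/-- The correlation of two distinct coordinates of a matched Gaussian. -/
def pairCoef (θ : ℝ) (par : Fin n → Option (Fin n)) (p i : Fin n) : ℝ :=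
  if par i = some p ∨ par p = some i then θ else 0

lemma pairCoef_sq_lt {θ : ℝ} (hθ : θ ^ 2 < 1) (par : Fin n → Option (Fin n)) (p i : Fin n) :
    pairCoef θ par p i ^ 2 < 1 := by
  unfold pairCoef
  split_ifs
  · exact hθ
  · simp

lemma lintegral_matchedGaussian_pair_of_par {θ : ℝ} (hθ : θ ^ 2 < 1)
    {par : Fin n → Option (Fin n)} (hM : IsMatching par) {p i : Fin n} (h : par i = some p)
    {F : ℝ → ℝ → ℝ≥0∞} (hF : Measurable F.uncurry) :
    ∫⁻ x, F (x p) (x i) ∂matchedGaussian θ par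
      = ∫⁻ x, ∫⁻ y, F x y * ENNReal.ofReal (corrDensity θ x y) ∂stdNormal ∂stdNormal := by
  have hF' : Measurable fun q : ℝ × ℝ => F q.1 q.2 := hF
  have hFx : ∀ x, Measurable (F x) := fun x => hF'.comp (measurable_const.prodMk measurable_id)
  have hFc : ∀ {f g : (Fin n → ℝ) → ℝ}, Measurable f → Measurable g →
      Measurable fun a => F (f a) (g a) := fun hf hg => hF'.comp (hf.prodMk hg)
  have hpi := hM.ne_of_par_eq h
  have hp := hM.par_eq_none h
  rw [lintegral_matchedGaussian _ _ (hFc (by fun_prop) (by fun_prop)),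
    lintegral_stdNormalPi_update i (F := fun z => F (couple θ par z p) (couple θ par z i))
      (hFc (by fun_prop) (by fun_prop))]
  simp_rw [couple_update_self_of_some hM h,
    couple_update_of_ne hpi (show par p ≠ some i by simp [hp]), couple_none hp]
  simp_rw [fun x => lintegral_affine_stdNormal hθ x (hFx x)]
  exact lintegral_stdNormalPi_eval p
    (F := fun x => ∫⁻ y, F x y * ENNReal.ofReal (corrDensity θ x y) ∂stdNormal)
    (Measurable.lintegral_prod_right' (hF'.mul (by fun_prop :
      Measurable fun q : ℝ × ℝ => ENNReal.ofReal (corrDensity θ q.1 q.2))))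

lemma lintegral_matchedGaussian_pair_of_ne {θ : ℝ} (hθ : θ ^ 2 < 1)
    {par : Fin n → Option (Fin n)} (hM : IsMatching par) {p i : Fin n} (hpi : p ≠ i)
    (h : par i ≠ some p) (h' : par p ≠ some i)
    {F : ℝ → ℝ → ℝ≥0∞} (hF : Measurable F.uncurry) :
    ∫⁻ x, F (x p) (x i) ∂matchedGaussian θ par = ∫⁻ x, ∫⁻ y, F x y ∂stdNormal ∂stdNormal := by
  have hF' : Measurable fun q : ℝ × ℝ => F q.1 q.2 := hF
  have hFx : ∀ x, Measurable (F x) := fun x => hF'.comp (measurable_const.prodMk measurable_id)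
  have hFc : ∀ {α : Type} [MeasurableSpace α] {f g : α → ℝ}, Measurable f → Measurable g →
      Measurable fun a => F (f a) (g a) := fun hf hg => hF'.comp (hf.prodMk hg)
  have hI : Measurable fun x => ∫⁻ y, F x y ∂stdNormal := Measurable.lintegral_prod_right' hF'
  rw [lintegral_matchedGaussian _ _ (hFc (by fun_prop) (by fun_prop)),
    lintegral_stdNormalPi_update i (F := fun z => F (couple θ par z p) (couple θ par z i))
      (hFc (by fun_prop) (by fun_prop)),
    ← lintegral_matchedGaussian_eval hθ hM p hI, lintegral_matchedGaussian _ _ (by fun_prop)]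
  rcases hi : par i with _ | a
  · simp_rw [couple_update_self_of_none hi, couple_update_of_ne hpi h']
  · have hap : p ≠ a := fun e => h (e ▸ hi)
    have ha := hM.par_eq_none hi
    -- The second coordinate is made of the coordinates `a` and `i` of the white noise, and the
    -- first one depends on neither of them.
    have hpa : par p ≠ some a := fun e => hpi (hM.inj e hi)
    simp_rw [couple_update_self_of_some hM hi, couple_update_of_ne hpi h']
    rw [lintegral_stdNormalPi_update a (Measurable.lintegral_prod_right'
      (f := fun q : (Fin n → ℝ) × ℝ => F (couple θ par q.1 p)
        (θ * couple θ par q.1 a + √(1 - θ ^ 2) * q.2)) (hFc (by fun_prop) (by fun_prop)))]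
    simp_rw [couple_update_self_of_none ha, couple_update_of_ne hap hpa]
    exact lintegral_congr fun z => lintegral_corrPair_snd hθ (hFx _)

/-- The joint law of two distinct coordinates of a matched Gaussian. -/
lemma lintegral_matchedGaussian_pair {θ : ℝ} (hθ : θ ^ 2 < 1)
    {par : Fin n → Option (Fin n)} (hM : IsMatching par) {p i : Fin n} (hpi : p ≠ i)
    {F : ℝ → ℝ → ℝ≥0∞} (hF : Measurable F.uncurry) :
    ∫⁻ x, F (x p) (x i) ∂matchedGaussian θ par
      = ∫⁻ x, ∫⁻ y, F x y * ENNReal.ofReal (corrDensity (pairCoef θ par p i) x y)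
          ∂stdNormal ∂stdNormal := by
  by_cases h : par i = some p
  · rw [lintegral_matchedGaussian_pair_of_par hθ hM h hF]
    simp [pairCoef, h]
  by_cases h' : par p = some i
  · have := lintegral_matchedGaussian_pair_of_par hθ hM h' (F := fun x y => F y x)
      (hF.comp measurable_swap)
    rw [this, lintegral_lintegral_swap]
    · simp only [pairCoef, h', or_true, if_true, corrDensity_swap θ]
    · exact ((hF.comp measurable_swap).mul (by fun_prop :
        Measurable fun q : ℝ × ℝ => ENNReal.ofReal (corrDensity θ q.1 q.2))).aemeasurable
  · rw [lintegral_matchedGaussian_pair_of_ne hθ hM hpi h h' hF]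
    simp [pairCoef, h, h', corrDensity_zero]

/-- Adding an edge to the matching multiplies the law by the likelihood ratio of that edge. -/
lemma lintegral_matchedGaussian_step {θ : ℝ} (hθ : θ ^ 2 < 1)
    {par : Fin n → Option (Fin n)} (hM : IsMatching par) {b a : Fin n} (h : par b = some a)
    {F : (Fin n → ℝ) → ℝ≥0∞} (hF : Measurable F) :
    ∫⁻ x, F x ∂matchedGaussian θ par
      = ∫⁻ x, F x * ENNReal.ofReal (corrDensity θ (x a) (x b))
          ∂matchedGaussian θ (Function.update par b none) := by
  set par' := Function.update par b none with hpar'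
  have hab := hM.ne_of_par_eq h
  have hb : par' b = none := by simp [par']
  have hnb : ∀ j, par' j ≠ some b := by
    intro j hj
    by_cases hjb : j = b
    · simp [hjb, hb] at hj
    · rw [hpar', Function.update_of_ne hjb] at hj
      simp [hM.par_eq_none hj] at h
  -- With the edge removed, the coordinate `b` is independent of all others.
  have e1 : ∀ z y, couple θ par' (Function.update z b y)
      = Function.update (couple θ par' z) b y := by
    intro z y
    ext j
    by_cases hjb : j = b
    · subst hjb; simp [couple_none hb]
    · rw [couple_update_of_ne hjb (hnb j), Function.update_of_ne hjb]
  have e2 : ∀ z y, couple θ par (Function.update z b y)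
      = Function.update (couple θ par' z) b
          (θ * couple θ par' z a + √(1 - θ ^ 2) * y) := by
    intro z y
    ext j
    by_cases hjb : j = b
    · subst hjb
      have : par' a = none := by rw [hpar', Function.update_of_ne hab]; exact hM.par_eq_none h
      simp [couple_some h, couple_none this, hab]
    · have hj : par j ≠ some b := by simpa [par', hjb] using hnb j
      rw [couple_update_of_ne hjb hj, Function.update_of_ne hjb]
      simp [couple, par', hjb]
  rw [lintegral_matchedGaussian _ _ hF, lintegral_matchedGaussian _ _ (by fun_prop),
    lintegral_stdNormalPi_update b (F := fun z => F (couple θ par z)) (by fun_prop),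
    lintegral_stdNormalPi_update b (F := fun z => F (couple θ par' z) *
      ENNReal.ofReal (corrDensity θ (couple θ par' z a) (couple θ par' z b))) (by fun_prop)]
  refine lintegral_congr fun z => ?_
  simp_rw [e1, e2, Function.update_self, Function.update_of_ne hab]
  exact lintegral_affine_stdNormal hθ _ (F := fun y => F (Function.update (couple θ par' z) b y))
    (by fun_prop)

lemma lintegral_fin_prod_eq_prod {m : ℕ} {E : Type*} [MeasurableSpace E] {μ : Fin m → Measure E}
    [∀ i, SigmaFinite (μ i)] {f : Fin m → E → ℝ≥0∞} (hf : ∀ i, Measurable (f i)) :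
    ∫⁻ x : Fin m → E, ∏ i, f i (x i) ∂(Measure.pi μ) = ∏ i, ∫⁻ x, f i x ∂(μ i) := by
  induction m with
  | zero => simp
  | succ m ih =>
    have hm : Measurable fun x : Fin m → E => ∏ i, f i.succ (x i) :=
      Finset.measurable_fun_prod _ fun i _ => (hf i.succ).comp (measurable_pi_apply i)
    rw [← ((measurePreserving_piFinSuccAbove μ 0).symm).lintegral_comp_emb
      (MeasurableEquiv.measurableEmbedding _), Fin.prod_univ_succ, ← ih fun i => hf i.succ,
      ← lintegral_prod_mul (hf 0).aemeasurable hm.aemeasurable]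
    refine lintegral_congr fun x => ?_
    simp [MeasurableEquiv.piFinSuccAbove_symm_apply, Fin.insertNthEquiv, Fin.prod_univ_succ]

lemma pi_withDensity {m : ℕ} {E : Type*} [MeasurableSpace E] {μ : Fin m → Measure E}
    [∀ i, SigmaFinite (μ i)] {f : Fin m → E → ℝ≥0∞} (hf : ∀ i, Measurable (f i))
    [∀ i, SigmaFinite ((μ i).withDensity (f i))] :
    Measure.pi (fun i => (μ i).withDensity (f i))
      = (Measure.pi μ).withDensity fun x => ∏ i, f i (x i) := by
  refine Measure.pi_eq fun s hs => ?_
  rw [withDensity_apply _ (MeasurableSet.univ_pi hs), Measure.restrict_pi_pi,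
    lintegral_fin_prod_eq_prod hf]
  exact Finset.prod_congr rfl fun i _ => (withDensity_apply _ (hs i)).symm

lemma stdNormalPi_eq_withDensity :
    stdNormalPi n = volume.withDensity fun x => ∏ i, gaussianPDF 0 1 (x i) := by
  have h : stdNormal = volume.withDensity (gaussianPDF 0 1) :=
    gaussianReal_of_var_ne_zero _ one_ne_zero
  have : SigmaFinite ((volume : Measure ℝ).withDensity (gaussianPDF 0 1)) := by
    rw [← h]; infer_instance
  rw [volume_pi, ← pi_withDensity fun _ => measurable_gaussianPDF _ _]
  simp_rw [← h]

lemma IsMatching.update_none {par : Fin n → Option (Fin n)} (hM : IsMatching par) (b : Fin n) :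
    IsMatching (Function.update par b none) := by
  have key : ∀ {j a}, Function.update par b none j = some a → par j = some a := by
    intro j a h
    by_cases hj : j = b
    · simp [hj] at h
    · rwa [Function.update_of_ne hj] at h
  refine ⟨fun {c a} h => ?_, fun h h' => hM.inj (key h) (key h')⟩
  by_cases hj : a = b
  · simp [hj]
  · rw [Function.update_of_ne hj]
    exact hM.par_eq_none (key h)

lemma matchedGaussian_step {θ : ℝ} (hθ : θ ^ 2 < 1)
    {par : Fin n → Option (Fin n)} (hM : IsMatching par) {b a : Fin n} (h : par b = some a) :
    matchedGaussian θ par = (matchedGaussian θ (Function.update par b none)).withDensity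
      fun x => ENNReal.ofReal (corrDensity θ (x a) (x b)) := by
  refine Measure.ext_of_lintegral _ fun F hF => ?_
  rw [lintegral_matchedGaussian_step hθ hM h hF,
    lintegral_withDensity_eq_lintegral_mul _ (by fun_prop) hF]
  simp [mul_comm]

/-- The likelihood ratio that the vertex `i` contributes to the density of a matched Gaussian. -/
noncomputable def edgeDensity (θ : ℝ) (par : Fin n → Option (Fin n)) (i : Fin n)
    (x : Fin n → ℝ) : ℝ :=
  (par i).elim 1 fun a => corrDensity θ (x a) (x i)

@[fun_prop]
lemma measurable_edgeDensity (θ : ℝ) (par : Fin n → Option (Fin n)) (i : Fin n) :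
    Measurable (edgeDensity θ par i) := by
  unfold edgeDensity
  rcases par i with _ | a
  · exact measurable_const
  · exact measurable_corrDensity θ (measurable_pi_apply a) (measurable_pi_apply i)

lemma edgeDensity_pos {θ : ℝ} (hθ : θ ^ 2 < 1) (par : Fin n → Option (Fin n)) (i : Fin n)
    (x : Fin n → ℝ) : 0 < edgeDensity θ par i x := by
  unfold edgeDensity
  rcases par i with _ | a
  · exact one_pos
  · exact corrDensity_pos hθ _ _

lemma matchedGaussian_eq_stdNormalPi_withDensity {θ : ℝ} (hθ : θ ^ 2 < 1)
    {par : Fin n → Option (Fin n)} (hM : IsMatching par) :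
    matchedGaussian θ par
      = (stdNormalPi n).withDensity fun x => ∏ i, ENNReal.ofReal (edgeDensity θ par i x) := by
  induction hk : (Finset.univ.filter fun i => par i ≠ none).card generalizing par with
  | zero =>
    have h0 : ∀ i, par i = none := by simpa using hk
    have h1 : couple θ par = id := by ext z i; simp [couple_none (h0 i)]
    simp [matchedGaussian, h1, edgeDensity, h0]
  | succ k ih =>
    obtain ⟨b, hb⟩ : (Finset.univ.filter fun i => par i ≠ none).Nonempty := by
      rw [← Finset.card_pos]; omega
    obtain ⟨a, ha⟩ := Option.ne_none_iff_exists'.1 (Finset.mem_filter.1 hb).2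
    have hc : (Finset.univ.filter fun i => Function.update par b none i ≠ none).card = k := by
      have : (Finset.univ.filter fun i => Function.update par b none i ≠ none)
          = (Finset.univ.filter fun i => par i ≠ none).erase b := by
        ext i
        by_cases hi : i = b <;> simp [hi]
      rw [this, Finset.card_erase_of_mem hb, hk]
      rfl
    rw [matchedGaussian_step hθ hM ha, ih (hM.update_none b) hc,
      ← withDensity_mul _ (by fun_prop) (by fun_prop)]
    congr 1
    ext x
    rw [Pi.mul_apply, ← Finset.prod_erase_mul _ _ (Finset.mem_univ b),
      ← Finset.prod_erase_mul _ (fun i => ENNReal.ofReal (edgeDensity θ par i x))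
        (Finset.mem_univ b)]
    have e1 : edgeDensity θ (Function.update par b none) b x = 1 := by simp [edgeDensity]
    have e2 : edgeDensity θ par b x = corrDensity θ (x a) (x b) := by simp [edgeDensity, ha]
    rw [e1, e2, ENNReal.ofReal_one, mul_one]
    congr 1
    refine Finset.prod_congr rfl fun i hi => ?_
    simp [edgeDensity, Finset.ne_of_mem_erase hi]

lemma matchedGaussian_eq_withDensity {θ : ℝ} (hθ : θ ^ 2 < 1)
    {par : Fin n → Option (Fin n)} (hM : IsMatching par) :
    matchedGaussian θ par = volume.withDensity fun x =>
      (∏ i, gaussianPDF 0 1 (x i)) * ∏ i, ENNReal.ofReal (edgeDensity θ par i x) := by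
  rw [matchedGaussian_eq_stdNormalPi_withDensity hθ hM, stdNormalPi_eq_withDensity,
    ← withDensity_mul _ (by fun_prop) (by fun_prop)]
  rfl

/-! ### Matched Gaussians are tree-structured -/

/-- The parent of `i` in the spider that extends a matching: the vertex matched to `i` if `i` is a
second vertex of an edge, and the centre `r` otherwise. -/
def spiderParent (par : Fin n → Option (Fin n)) (r i : Fin n) : Fin n := (par i).getD r

/-- The tree of depth at most two that contains all edges of a matching: first vertices and
unmatched vertices are joined to the centre `r`. -/
def spider (par : Fin n → Option (Fin n)) (r : Fin n) : SimpleGraph (Fin n) :=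
  SimpleGraph.fromRel fun p i => i ≠ r ∧ spiderParent par r i = p

section Spider

variable {par : Fin n → Option (Fin n)} {r : Fin n}

lemma spiderParent_ne (hM : IsMatching par) {i : Fin n} (hi : i ≠ r) :
    spiderParent par r i ≠ i := by
  unfold spiderParent
  rcases h : par i with _ | a
  · exact hi.symm
  · exact hM.ne_of_par_eq h

lemma spiderParent_spiderParent (hM : IsMatching par) {i : Fin n} (hi : spiderParent par r i ≠ r) :
    spiderParent par r (spiderParent par r i) = r := by
  rcases h : par i with _ | a
  · simp [spiderParent, h] at hi
  · simp [spiderParent, h, hM.par_eq_none h]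

lemma spider_adj {p i : Fin n} : (spider par r).Adj p i ↔
    p ≠ i ∧ ((i ≠ r ∧ spiderParent par r i = p) ∨ (p ≠ r ∧ spiderParent par r p = i)) :=
  SimpleGraph.fromRel_adj _ _ _

lemma spider_adj_spiderParent (hM : IsMatching par) {i : Fin n} (hi : i ≠ r) :
    (spider par r).Adj (spiderParent par r i) i :=
  spider_adj.2 ⟨spiderParent_ne hM hi, Or.inl ⟨hi, rfl⟩⟩

lemma spider_connected (hM : IsMatching par) : (spider par r).Connected := by
  have h1 : ∀ i, spiderParent par r i = r → (spider par r).Reachable r i := by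
    intro i h
    by_cases hi : i = r
    · rw [hi]
    · have := (spider_adj_spiderParent hM hi).reachable
      rwa [h] at this
  have h2 : ∀ i, (spider par r).Reachable r i := by
    intro i
    by_cases hp : spiderParent par r i = r
    · exact h1 i hp
    by_cases hi : i = r
    · rw [hi]
    · exact (h1 _ (spiderParent_spiderParent hM hp)).trans (spider_adj_spiderParent hM hi).reachable
  have : Nonempty (Fin n) := ⟨r⟩
  exact ⟨fun i j => (h2 i).symm.trans (h2 j)⟩

lemma spider_isTree (hM : IsMatching par) : (spider par r).IsTree := by
  classical
  have hc := spider_connected (r := r) hM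
  rw [SimpleGraph.isTree_iff_connected_and_card]
  refine ⟨hc, le_antisymm ?_ hc.card_vert_le_card_edgeSet_add_one⟩
  have hsub : (spider par r).edgeSet ⊆
      ((Finset.univ.erase r).image fun i => s(spiderParent par r i, i) :
        Finset (Sym2 (Fin n))) := by
    intro e
    induction e with
    | _ a b =>
      intro h
      rcases (spider_adj.1 ((SimpleGraph.mem_edgeSet _).1 h)).2 with h | h
      · simp only [Finset.coe_image, Set.mem_image]
        exact ⟨b, by simpa using h.1, by rw [h.2]⟩
      · simp only [Finset.coe_image, Set.mem_image]
        exact ⟨a, by simpa using h.1, by rw [h.2, Sym2.eq_swap]⟩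
  have h1 : Nat.card (spider par r).edgeSet ≤ (Finset.univ.erase r).card := by
    rw [Nat.card_coe_set_eq]
    refine (Set.ncard_le_ncard hsub (Finset.finite_toSet _)).trans ?_
    rw [Set.ncard_coe_finset]
    exact Finset.card_image_le
  have h2 := Finset.card_erase_add_one (Finset.mem_univ r)
  rw [Finset.card_univ, Fintype.card_fin] at h2
  rw [Nat.card_fin]
  omega

lemma spider_dist_of_spiderParent_eq (hM : IsMatching par) {i : Fin n} (hi : i ≠ r)
    (h : spiderParent par r i = r) : (spider par r).dist r i = 1 := by
  rw [SimpleGraph.dist_eq_one_iff_adj]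
  simpa [h] using spider_adj_spiderParent hM hi

lemma spider_dist_of_spiderParent_ne (hM : IsMatching par) {i : Fin n} (hi : i ≠ r)
    (h : spiderParent par r i ≠ r) : (spider par r).dist r i = 2 := by
  have hc := spider_connected (r := r) hM
  have h1 := hc.dist_triangle (u := r) (v := spiderParent par r i) (w := i)
  rw [spider_dist_of_spiderParent_eq hM h (spiderParent_spiderParent hM h),
    SimpleGraph.dist_eq_one_iff_adj.2 (spider_adj_spiderParent hM hi)] at h1
  have h2 := hc.pos_dist_of_ne hi.symm
  have h3 : (spider par r).dist r i ≠ 1 := by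
    rw [Ne, SimpleGraph.dist_eq_one_iff_adj, spider_adj]
    simp [h]
  omega

lemma isParent_spider_iff (hM : IsMatching par) {p i : Fin n} :
    IsParent (spider par r) r p i ↔ i ≠ r ∧ spiderParent par r i = p := by
  have hd : ∀ i, i ≠ r → (spider par r).dist r i
      = (spider par r).dist r (spiderParent par r i) + 1 := by
    intro i hi
    by_cases h : spiderParent par r i = r
    · rw [spider_dist_of_spiderParent_eq hM hi h, h, SimpleGraph.dist_self]
    · rw [spider_dist_of_spiderParent_ne hM hi h, spider_dist_of_spiderParent_eq hM h
        (spiderParent_spiderParent hM h)]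
  constructor
  · rintro ⟨hadj, hdist⟩
    rcases (spider_adj.1 hadj).2 with h | h
    · exact h
    · have := hd p h.1
      rw [h.2] at this
      omega
  · rintro ⟨hi, rfl⟩
    exact ⟨spider_adj_spiderParent hM hi, hd i hi⟩

end Spider

lemma not_mem_nonDesc_of_isParent {T : SimpleGraph (Fin n)} {r i j : Fin n}
    (h : IsParent T r i j) : j ∉ nonDesc T r i := fun hj => hj (.single h)

lemma self_not_mem_nonDesc {T : SimpleGraph (Fin n)} {r i : Fin n} : i ∉ nonDesc T r i :=
  fun hj => hj .refl

/-- If, given `(k, W)`, the law of `V` depends on `k` only, then `V` and `W` are conditionally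
independent given `k`. -/
lemma condIndepFun_of_lintegral_eq {Ω β : Type*} [MeasurableSpace Ω] [StandardBorelSpace Ω]
    [MeasurableSpace β] [StandardBorelSpace β] [Nonempty β] {μ : Measure Ω} [IsFiniteMeasure μ]
    {V k : Ω → ℝ} {W : Ω → β} (hV : Measurable V) (hk : Measurable k) (hW : Measurable W)
    (η : Kernel ℝ ℝ) [IsMarkovKernel η]
    (h : ∀ F : (ℝ × β) × ℝ → ℝ≥0∞, Measurable F → ∫⁻ ω, F ((k ω, W ω), V ω) ∂μ
      = ∫⁻ ω, ∫⁻ v, F ((k ω, W ω), v) ∂(η (k ω)) ∂μ) :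
    CondIndepFun (MeasurableSpace.comap k inferInstance) hk.comap_le V W μ := by
  refine CondIndepFun.symm ?_
  rw [condIndepFun_iff_condDistrib_prod_ae_eq_prodMkRight hV hW hk]
  have h1 : condDistrib V (fun ω => (k ω, W ω)) μ =ᵐ[μ.map fun ω => (k ω, W ω)]
      η.prodMkRight β := by
    refine condDistrib_ae_eq_of_measure_eq_compProd _ hV.aemeasurable ?_
    refine Measure.ext_of_lintegral _ fun F hF => ?_
    rw [lintegral_map hF (by fun_prop), Measure.lintegral_compProd hF,
      lintegral_map _ (by fun_prop),
      h F hF]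
    · rfl
    · exact hF.lintegral_kernel_prod_right'
  have h2 : condDistrib V k μ =ᵐ[μ.map k] η := by
    refine condDistrib_ae_eq_of_measure_eq_compProd _ hV.aemeasurable ?_
    refine Measure.ext_of_lintegral _ fun F hF => ?_
    rw [lintegral_map hF (by fun_prop), Measure.lintegral_compProd hF,
      lintegral_map _ (by fun_prop)]
    · exact h (fun q => F (q.1.1, q.2)) (by fun_prop)
    · exact hF.lintegral_kernel_prod_right'
  have h3 : ∀ᵐ q ∂μ.map (fun ω => (k ω, W ω)), condDistrib V k μ q.1 = η q.1 := by
    have : (μ.map fun ω => (k ω, W ω)).map Prod.fst = μ.map k := by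
      rw [Measure.map_map measurable_fst (by fun_prop)]
      rfl
    rw [← this] at h2
    exact ae_of_ae_map (by fun_prop) h2
  filter_upwards [h1, h3] with q hq hq'
  rw [hq, Kernel.prodMkRight_apply, Kernel.prodMkRight_apply, hq']

/-- The conditional law of a coordinate given its parent, when the two have correlation `c`. -/
noncomputable def affineKernel (c : ℝ) : Kernel ℝ ℝ :=
  (Kernel.id ×ₖ Kernel.const ℝ stdNormal).map fun q => c * q.1 + √(1 - c ^ 2) * q.2

instance (c : ℝ) : IsMarkovKernel (affineKernel c) :=
  Kernel.IsMarkovKernel.map _ (by fun_prop)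

lemma lintegral_affineKernel (c a : ℝ) {F : ℝ → ℝ≥0∞} (hF : Measurable F) :
    ∫⁻ v, F v ∂affineKernel c a = ∫⁻ y, F (c * a + √(1 - c ^ 2) * y) ∂stdNormal := by
  rw [affineKernel, Kernel.lintegral_map _ (by fun_prop) _ hF,
    Kernel.lintegral_prod _ _ _ (by fun_prop),
    Kernel.lintegral_id' (by fun_prop)]
  simp

/-- The white noise that drives a coordinate `i` enters no coordinate other than `i` and its
descendants, so given its parent the coordinate is independent of the rest. -/
lemma localMarkov_matchedGaussian {θ : ℝ} {par : Fin n → Option (Fin n)}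
    (hM : IsMatching par) {r : Fin n} (hr : par r = none) :
    LocalMarkov (spider par r) r (matchedGaussian θ par) := by
  intro i p hip
  obtain ⟨hi, hpi⟩ := (isParent_spider_iff hM).1 hip
  have hp0 : p ≠ i := hpi ▸ spiderParent_ne hM hi
  have hpar : ∀ {j}, par j = some i → IsParent (spider par r) r i j := fun {j} h =>
    (isParent_spider_iff hM).2
      ⟨fun hj => by simp [hj, hr] at h, by simp [spiderParent, h]⟩
  have hpp : par p ≠ some i := by
    intro h
    have hp : p = r := by rw [← hpi, spiderParent, hM.par_eq_none h, Option.getD_none]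
    simp [hp, hr] at h
  obtain ⟨c, hc⟩ : ∃ c : ℝ, ∀ z y, couple θ par (Function.update z i y) i
      = c * couple θ par z p + √(1 - c ^ 2) * y := by
    rcases h : par i with _ | a
    · exact ⟨0, fun z y => by simp [couple_update_self_of_none h]⟩
    · have : a = p := by simpa [spiderParent, h] using hpi
      exact ⟨θ, fun z y => by rw [couple_update_self_of_some hM h, this]⟩
  refine condIndepFun_of_lintegral_eq (measurable_pi_apply i) (measurable_pi_apply p)
    (measurable_pi_lambda _ fun j => measurable_pi_apply _) (affineKernel c) fun F hF => ?_
  have hW : ∀ z y (j : nonDesc (spider par r) r i),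
      couple θ par (Function.update z i y) j = couple θ par z j := fun z y j =>
    couple_update_of_ne (fun e => self_not_mem_nonDesc (e ▸ j.2))
      (fun e => not_mem_nonDesc_of_isParent (hpar e) j.2) z y
  have hm : Measurable fun x : Fin n → ℝ => fun j : nonDesc (spider par r) r i => x j :=
    measurable_pi_lambda _ fun j => measurable_pi_apply _
  have hm' : Measurable fun x : Fin n → ℝ =>
      ∫⁻ v, F ((x p, fun j : nonDesc (spider par r) r i => x j), v) ∂(affineKernel c (x p)) := by
    simp_rw [fun x : Fin n → ℝ => lintegral_affineKernel c (x p)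
      (F := fun v => F ((x p, fun j : nonDesc (spider par r) r i => x j), v)) (by fun_prop)]
    refine Measurable.lintegral_prod_right' (f := fun q : (Fin n → ℝ) × ℝ =>
      F ((q.1 p, fun j : nonDesc (spider par r) r i => q.1 j), c * q.1 p + √(1 - c ^ 2) * q.2)) ?_
    fun_prop
  rw [lintegral_matchedGaussian _ _ (by fun_prop), lintegral_matchedGaussian _ _ hm',
    lintegral_stdNormalPi_update i (F := fun z => F ((couple θ par z p,
      fun j : nonDesc (spider par r) r i => couple θ par z j), couple θ par z i)) (by fun_prop)]
  refine lintegral_congr fun z => ?_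
  rw [lintegral_affineKernel _ _ (by fun_prop)]
  simp_rw [hW, hc, couple_update_of_ne hp0 hpp]

lemma volume_absolutelyContinuous_stdNormalPi :
    (volume : Measure (Fin n → ℝ)) ≪ stdNormalPi n := by
  rw [stdNormalPi_eq_withDensity]
  refine withDensity_absolutelyContinuous' (Measurable.aemeasurable (by fun_prop))
    (.of_forall fun x => ?_)
  exact Finset.prod_ne_zero_iff.2 fun i _ => (gaussianPDF_pos _ one_ne_zero _).ne'

lemma stdNormal_absolutelyContinuous : stdNormal ≪ volume :=
  gaussianReal_absolutelyContinuous _ one_ne_zero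

lemma matchedGaussian_none (θ : ℝ) : matchedGaussian θ (fun _ : Fin n => none) = stdNormalPi n := by
  have : couple θ (fun _ : Fin n => none) = id := by ext z i; simp [couple]
  simp [matchedGaussian, this]

lemma isMatching_none : IsMatching fun _ : Fin n => none :=
  ⟨fun h => by simp at h, fun h => by simp at h⟩

lemma map_eval_matchedGaussian {θ : ℝ} (hθ : θ ^ 2 < 1) {par : Fin n → Option (Fin n)}
    (hM : IsMatching par) (i : Fin n) :
    (matchedGaussian θ par).map (fun x => x i) = volume.withDensity (gaussianPDF 0 1) := by
  rw [← gaussianReal_of_var_ne_zero _ one_ne_zero]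
  refine Measure.ext_of_lintegral _ fun F hF => ?_
  rw [lintegral_map hF (by fun_prop), lintegral_matchedGaussian_eval hθ hM i hF]

lemma map_pair_matchedGaussian {θ : ℝ} (hθ : θ ^ 2 < 1) {par : Fin n → Option (Fin n)}
    (hM : IsMatching par) {p i : Fin n} (hpi : p ≠ i) :
    (matchedGaussian θ par).map (fun x => (x p, x i))
      = (volume : Measure (ℝ × ℝ)).withDensity fun q => gaussianPDF 0 1 q.1 *
        (gaussianPDF 0 1 q.2 * ENNReal.ofReal (corrDensity (pairCoef θ par p i) q.1 q.2)) := by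
  refine Measure.ext_of_lintegral _ fun F hF => ?_
  rw [lintegral_map hF (by fun_prop),
    lintegral_matchedGaussian_pair hθ hM hpi (F := fun x y => F (x, y)) hF,
    lintegral_withDensity_eq_lintegral_mul _ (by fun_prop) hF, Measure.volume_eq_prod,
    lintegral_prod _ (by fun_prop), lintegral_stdNormal
      (Measurable.lintegral_prod_right' (f := fun q : ℝ × ℝ => F (q.1, q.2) *
        ENNReal.ofReal (corrDensity (pairCoef θ par p i) q.1 q.2)) (by fun_prop))]
  refine lintegral_congr fun x => ?_
  rw [lintegral_stdNormal (by fun_prop), ← lintegral_const_mul _ (by fun_prop)]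
  refine lintegral_congr fun y => ?_
  simp only [Pi.mul_apply]
  ring

/-- Null sets of the plane pull back to null sets under a projection to two distinct coordinates, so
densities of pairs, which are unique only almost everywhere, can be evaluated along the projection. -/
lemma quasiMeasurePreserving_pair {p i : Fin n} (hpi : p ≠ i) :
    Measure.QuasiMeasurePreserving (fun x : Fin n → ℝ => (x p, x i)) volume volume := by
  refine ⟨by fun_prop, ?_⟩
  refine (volume_absolutelyContinuous_stdNormalPi.map (by fun_prop)).trans ?_
  rw [← matchedGaussian_none 0, map_pair_matchedGaussian (by norm_num) isMatching_none hpi]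
  exact withDensity_absolutelyContinuous _ _

lemma quasiMeasurePreserving_coord (i : Fin n) :
    Measure.QuasiMeasurePreserving (fun x : Fin n → ℝ => x i) volume volume :=
  Measure.quasiMeasurePreserving_eval (fun _ : Fin n => (volume : Measure ℝ)) i

lemma dens_matchedGaussian {θ : ℝ} (hθ : θ ^ 2 < 1) {par : Fin n → Option (Fin n)}
    (hM : IsMatching par) (i : Fin n) :
    ∀ᵐ x : Fin n → ℝ, dens (matchedGaussian θ par) i (x i) = gaussianPDF 0 1 (x i) := by
  refine (quasiMeasurePreserving_coord i).ae (p := fun a =>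
    dens (matchedGaussian θ par) i a = gaussianPDF 0 1 a) ?_
  rw [dens, pdf_def, map_eval_matchedGaussian hθ hM]
  exact Measure.rnDeriv_withDensity _ (measurable_gaussianPDF _ _)

lemma condDens_matchedGaussian {θ : ℝ} (hθ : θ ^ 2 < 1) {par : Fin n → Option (Fin n)}
    (hM : IsMatching par) {p i : Fin n} (hpi : p ≠ i) :
    ∀ᵐ x : Fin n → ℝ, condDens (matchedGaussian θ par) i p (x i) (x p)
      = gaussianPDF 0 1 (x i) * ENNReal.ofReal (corrDensity (pairCoef θ par p i) (x p) (x i)) := by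
  have h : ∀ᵐ x : Fin n → ℝ, pdf (fun x : Fin n → ℝ => (x p, x i)) (matchedGaussian θ par) volume
      (x p, x i) = gaussianPDF 0 1 (x p) * (gaussianPDF 0 1 (x i) *
        ENNReal.ofReal (corrDensity (pairCoef θ par p i) (x p) (x i))) := by
    refine (quasiMeasurePreserving_pair hpi).ae (p := fun q =>
      pdf (fun x : Fin n → ℝ => (x p, x i)) (matchedGaussian θ par) volume q
      = gaussianPDF 0 1 q.1 * (gaussianPDF 0 1 q.2 *
        ENNReal.ofReal (corrDensity (pairCoef θ par p i) q.1 q.2))) ?_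
    rw [pdf_def, map_pair_matchedGaussian hθ hM hpi]
    exact Measure.rnDeriv_withDensity _ (by fun_prop)
  filter_upwards [h, dens_matchedGaussian hθ hM p] with x h1 h2
  rw [condDens, h1, h2, ENNReal.div_eq_inv_mul, ← mul_assoc, ENNReal.inv_mul_cancel
    (gaussianPDF_pos _ one_ne_zero _).ne' gaussianPDF_ne_top, one_mul]

lemma factorizes_matchedGaussian {θ : ℝ} (hθ : θ ^ 2 < 1) {par : Fin n → Option (Fin n)}
    (hM : IsMatching par) {r : Fin n} (hr : par r = none) :
    Factorizes (spider par r) r (matchedGaussian θ par) := by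
  classical
  have h1 : (matchedGaussian θ par).rnDeriv volume =ᵐ[volume] fun x =>
      (∏ i, gaussianPDF 0 1 (x i)) * ∏ i, ENNReal.ofReal (edgeDensity θ par i x) := by
    rw [matchedGaussian_eq_withDensity hθ hM]
    exact Measure.rnDeriv_withDensity _ (by fun_prop)
  have h2 : ∀ᵐ x : Fin n → ℝ, ∀ p i : Fin n, p ≠ i →
      condDens (matchedGaussian θ par) i p (x i) (x p) = gaussianPDF 0 1 (x i) *
        ENNReal.ofReal (corrDensity (pairCoef θ par p i) (x p) (x i)) := by
    simp_rw [ae_all_iff]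
    exact fun p i hpi => condDens_matchedGaussian hθ hM hpi
  filter_upwards [h1, h2, dens_matchedGaussian hθ hM r] with x hx1 hx2 hx3
  rw [hx1, hx3, ← Finset.mul_prod_erase _ _ (Finset.mem_univ r),
    ← Finset.mul_prod_erase _ (fun i => ENNReal.ofReal (edgeDensity θ par i x)) (Finset.mem_univ r),
    ← Finset.mul_prod_erase _ (fun i => ∏ p with IsParent (spider par r) r p i, _)
      (Finset.mem_univ r)]
  have er : edgeDensity θ par r x = 1 := by simp [edgeDensity, hr]
  have e0 : (Finset.univ.filter fun p => IsParent (spider par r) r p r) = ∅ := by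
    ext p; simp [isParent_spider_iff hM]
  rw [er, e0, Finset.prod_empty, ENNReal.ofReal_one, one_mul, one_mul, mul_assoc,
    ← Finset.prod_mul_distrib]
  congr 1
  refine Finset.prod_congr rfl fun i hi => ?_
  have hir := Finset.ne_of_mem_erase hi
  have e1 : (Finset.univ.filter fun p => IsParent (spider par r) r p i)
      = {spiderParent par r i} := by
    ext p; simp [isParent_spider_iff hM, hir, eq_comm]
  rw [e1, Finset.prod_singleton, hx2 _ _ (spiderParent_ne hM hir)]
  congr 2
  rcases h : par i with _ | a
  · simp [edgeDensity, h, pairCoef, spiderParent, hr, corrDensity_zero]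
  · simp [edgeDensity, h, pairCoef, spiderParent]

lemma isTreeStructuredBy_matchedGaussian {θ : ℝ} (hθ : θ ^ 2 < 1) {par : Fin n → Option (Fin n)}
    (hM : IsMatching par) {r : Fin n} (hr : par r = none) :
    IsTreeStructuredBy (spider par r) (matchedGaussian θ par) where
  isTree := spider_isTree hM
  hasDensity := by
    rw [matchedGaussian_eq_withDensity hθ hM]
    exact withDensity_absolutelyContinuous _ _
  markov := ⟨r, localMarkov_matchedGaussian hM hr, factorizes_matchedGaussian hθ hM hr⟩

lemma optDiv_matchedGaussian {θ : ℝ} (hθ : θ ^ 2 < 1) {par : Fin n → Option (Fin n)}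
    (hM : IsMatching par) {r : Fin n} (hr : par r = none) :
    optDiv (matchedGaussian θ par) = 0 := by
  refine le_antisymm ?_ zero_le
  rw [← InformationTheory.klDiv_self (matchedGaussian θ par)]
  exact iInf_le_of_le (spider par r) <| iInf_le_of_le (matchedGaussian θ par) <|
    iInf_le_of_le inferInstance <|
      iInf_le_of_le (isTreeStructuredBy_matchedGaussian hθ hM hr) le_rfl

/-! ### The divergence from a tree that misses edges of the matching -/

section RootedTree

variable {T : SimpleGraph (Fin n)}

lemma IsParent.ne {r p i : Fin n} (h : IsParent T r p i) : p ≠ i := h.1.ne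

lemma not_isParent_root {r p : Fin n} : ¬ IsParent T r p r := by
  rintro ⟨-, h⟩
  simp at h

lemma existsUnique_isParent (hT : T.IsTree) {r i : Fin n} (hi : i ≠ r) :
    ∃! p, IsParent T r p i := by
  obtain ⟨q, hq, hl⟩ := hT.connected.exists_path_of_dist r i
  have hnil : ¬ q.Nil := SimpleGraph.Walk.not_nil_of_ne hi.symm
  have hadj := q.adj_penultimate hnil
  refine ⟨q.penultimate, ⟨hadj, ?_⟩, ?_⟩
  · have h1 : T.dist r q.penultimate ≤ q.length - 1 := by
      simpa using SimpleGraph.dist_le q.dropLast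
    have h2 : 0 < q.length := SimpleGraph.Walk.not_nil_iff_lt_length.1 hnil
    rcases hT.dist_eq_dist_add_one_of_adj r hadj with h | h <;> omega
  · rintro p ⟨hp, hd⟩
    obtain ⟨w, hw, hwl⟩ := hT.connected.exists_path_of_dist r p
    have his : i ∉ w.support := by
      classical
      intro his
      have h3 := SimpleGraph.dist_le (w.takeUntil i his)
      have h4 := w.length_takeUntil_le_length his
      omega
    exact hT.isAcyclic.eq_penultimate_of_adj_end hq hp.symm
      (hT.isAcyclic.mem_support_of_ne_mem_support_of_adj_of_isPath hq hw hp.symm his)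

lemma isParent_or_isParent_of_adj (hT : T.IsTree) (r : Fin n) {a b : Fin n} (h : T.Adj a b) :
    IsParent T r a b ∨ IsParent T r b a := by
  rcases hT.dist_eq_dist_add_one_of_adj r h with h' | h'
  · exact Or.inr ⟨h.symm, h'⟩
  · exact Or.inl ⟨h, h'⟩

lemma not_isParent_of_isParent {r a b : Fin n} (h : IsParent T r a b) : ¬ IsParent T r b a := by
  intro h'
  have h1 := h.2
  have h2 := h'.2
  omega

open Classical in
lemma sum_isParent_const (hT : T.IsTree) (r : Fin n) (f : Fin n → ℝ) :
    f r + ∑ i, ∑ _p with IsParent T r _p i, f i = ∑ i, f i := by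
  rw [← Finset.add_sum_erase _ f (Finset.mem_univ r),
    ← Finset.add_sum_erase _ (fun i => ∑ _p with IsParent T r _p i, f i) (Finset.mem_univ r)]
  have h0 : (Finset.univ.filter fun p => IsParent T r p r) = ∅ := by
    ext p; simp [not_isParent_root]
  rw [h0, Finset.sum_empty, zero_add]
  congr 1
  refine Finset.sum_congr rfl fun i hi => ?_
  obtain ⟨p, hp, hu⟩ := existsUnique_isParent hT (Finset.ne_of_mem_erase hi)
  have h1 : (Finset.univ.filter fun p => IsParent T r p i) = {p} := by
    ext p'
    simp only [Finset.mem_filter, Finset.mem_univ, true_and, Finset.mem_singleton]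
    exact ⟨hu p', fun h => h ▸ hp⟩
  rw [h1, Finset.sum_singleton]

end RootedTree

/-- The edges of the matching that are missing from `T`, each represented by its second vertex. -/
def missingEdges (par : Fin n → Option (Fin n)) (T : SimpleGraph (Fin n)) : Set (Fin n) :=
  {i | ∃ p, par i = some p ∧ ¬ T.Adj p i}

open Classical in
/-- The edges of a rooted tree see exactly the log-likelihood ratios of the matching edges that
belong to the tree. -/
lemma sum_log_edgeDensity_sub {θ : ℝ} {par : Fin n → Option (Fin n)} (hM : IsMatching par)
    {T : SimpleGraph (Fin n)} (hT : T.IsTree) (r : Fin n) (x : Fin n → ℝ) :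
    ∑ i, Real.log (edgeDensity θ par i x)
      - ∑ i, ∑ p with IsParent T r p i, Real.log (corrDensity (pairCoef θ par p i) (x p) (x i))
      = ∑ i with i ∈ missingEdges par T, Real.log (edgeDensity θ par i x) := by
  set ℓ : Fin n → Fin n → ℝ := fun p i => Real.log (corrDensity θ (x p) (x i)) with hℓ
  have hlog : ∀ i, Real.log (edgeDensity θ par i x)
      = ∑ p, if par i = some p then ℓ p i else 0 := by
    intro i
    rcases h : par i with _ | a
    · simp [edgeDensity, h]
    · simp [edgeDensity, h, hℓ]
  have hpair : ∀ p i, Real.log (corrDensity (pairCoef θ par p i) (x p) (x i))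
      = (if par i = some p then ℓ p i else 0) + (if par p = some i then ℓ i p else 0) := by
    intro p i
    by_cases h : par i = some p
    · simp [pairCoef, h, hM.par_eq_none h, hℓ]
    · by_cases h' : par p = some i
      · simp [pairCoef, h, h', hℓ, corrDensity_swap θ (x p)]
      · simp [pairCoef, h, h', corrDensity_zero]
  have htree : ∑ i, ∑ p with IsParent T r p i,
      Real.log (corrDensity (pairCoef θ par p i) (x p) (x i))
      = ∑ i, ∑ p, if par i = some p then (if T.Adj p i then ℓ p i else 0) else 0 := by
    calc _ = ∑ i, ∑ p, (if IsParent T r p i then (if par i = some p then ℓ p i else 0) else 0)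
          + ∑ i, ∑ p, (if IsParent T r p i then (if par p = some i then ℓ i p else 0) else 0) := by
          rw [← Finset.sum_add_distrib]
          refine Finset.sum_congr rfl fun i _ => ?_
          rw [← Finset.sum_add_distrib, Finset.sum_filter]
          refine Finset.sum_congr rfl fun p _ => ?_
          rw [hpair]
          split_ifs <;> simp
      _ = _ := by
          rw [Finset.sum_comm (f := fun i p => if IsParent T r p i then
            (if par p = some i then ℓ i p else 0) else 0), ← Finset.sum_add_distrib]
          refine Finset.sum_congr rfl fun i _ => ?_
          rw [← Finset.sum_add_distrib]
          refine Finset.sum_congr rfl fun p _ => ?_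
          by_cases h : par i = some p
          · simp only [h, if_true]
            by_cases hadj : T.Adj p i
            · rcases isParent_or_isParent_of_adj hT r hadj with h' | h' <;>
                simp [h', not_isParent_of_isParent h', hadj]
            · have h1 : ¬ IsParent T r p i := fun h => hadj h.1
              have h2 : ¬ IsParent T r i p := fun h => hadj h.1.symm
              simp [h1, h2, hadj]
          · simp [h]
  rw [htree, Finset.sum_filter, ← Finset.sum_sub_distrib]
  refine Finset.sum_congr rfl fun i _ => ?_
  rcases h : par i with _ | a
  · simp [missingEdges, edgeDensity, h]
  · by_cases hadj : T.Adj a i <;> simp [missingEdges, edgeDensity, h, hadj, hℓ]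

section Ratios

variable {Q : Measure (Fin n → ℝ)}

lemma lintegral_dens_le_one (Q : Measure (Fin n → ℝ)) [IsProbabilityMeasure Q] (i : Fin n) :
    ∫⁻ a, dens Q i a ≤ 1 := by
  refine (Measure.lintegral_rnDeriv_le).trans ?_
  rw [Measure.map_apply (measurable_pi_apply i) MeasurableSet.univ]
  exact prob_le_one

lemma lintegral_pdf_pair_le [IsProbabilityMeasure Q] (hQ : Q ≪ volume) (p i : Fin n) :
    ∀ᵐ a, ∫⁻ b, pdf (fun x : Fin n → ℝ => (x p, x i)) Q volume (a, b) ≤ dens Q p a := by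
  have hac : Q.map (fun x => x p) ≪ volume :=
    (hQ.map (measurable_pi_apply p)).trans (quasiMeasurePreserving_coord p).absolutelyContinuous
  have hm : Measurable (pdf (fun x : Fin n → ℝ => (x p, x i)) Q volume) := measurable_pdf _ _ _
  refine ae_le_of_forall_setLIntegral_le_of_sigmaFinite (Measurable.lintegral_prod_right' hm)
    fun s hs _ => ?_
  have h1 : ∫⁻ a in s, dens Q p a = Q ((fun x => x p) ⁻¹' s) := by
    rw [← Measure.map_apply (measurable_pi_apply p) hs]
    exact Measure.setLIntegral_rnDeriv hac s
  have h2 : ∫⁻ a in s, ∫⁻ b, pdf (fun x : Fin n → ℝ => (x p, x i)) Q volume (a, b)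
      = ∫⁻ q in s ×ˢ Set.univ, pdf (fun x : Fin n → ℝ => (x p, x i)) Q volume q := by
    have key : ∀ f : ℝ × ℝ → ℝ≥0∞, Measurable f →
        ∫⁻ a in s, ∫⁻ b, f (a, b) = ∫⁻ q in s ×ˢ Set.univ, f q := fun f hf => by
      rw [Measure.volume_eq_prod, setLIntegral_prod _ hf.aemeasurable]
      simp
    exact key _ hm
  rw [h1, h2]
  refine (setLIntegral_pdf_le_map _ _ _ _).trans ?_
  rw [Measure.map_apply (by fun_prop) (hs.prod MeasurableSet.univ)]
  exact measure_mono fun x hx => hx.1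

@[fun_prop]
lemma measurable_dens (i : Fin n) : Measurable (dens Q i) := measurable_pdf _ _ _

@[fun_prop]
lemma measurable_condDens (i p : Fin n) : Measurable fun q : ℝ × ℝ => condDens Q i p q.1 q.2 := by
  unfold condDens
  refine Measurable.div ?_ (by fun_prop)
  exact (measurable_pdf (fun x : Fin n → ℝ => (x p, x i)) Q volume).comp measurable_swap

variable {θ : ℝ} {par : Fin n → Option (Fin n)}

/-- Under `P`, the density of the root under `Q` divided by that under `P` has expectation at most
one. -/
lemma lintegral_rootRatio_le_one [IsProbabilityMeasure Q] (hθ : θ ^ 2 < 1) (hM : IsMatching par)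
    (r : Fin n) : ∫⁻ x, dens Q r (x r) / gaussianPDF 0 1 (x r) ∂matchedGaussian θ par ≤ 1 := by
  rw [lintegral_matchedGaussian_eval hθ hM r (F := fun a => dens Q r a / gaussianPDF 0 1 a)
    (by fun_prop), lintegral_stdNormal (by fun_prop)]
  refine le_trans (lintegral_mono fun a => ?_) (lintegral_dens_le_one Q r)
  exact ENNReal.mul_div_le

/-- Under `P`, a conditional density of `Q` divided by that of `P` has expectation at most one: the
law of the pair under `P` cancels the denominator, and a conditional density of `Q` integrates to at
most one. -/
lemma lintegral_edgeRatio_le_one [IsProbabilityMeasure Q] (hθ : θ ^ 2 < 1) (hM : IsMatching par)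
    (hQ : Q ≪ volume) {p i : Fin n} (hpi : p ≠ i) :
    ∫⁻ x, condDens Q i p (x i) (x p) / (gaussianPDF 0 1 (x i) *
      ENNReal.ofReal (corrDensity (pairCoef θ par p i) (x p) (x i)))
      ∂matchedGaussian θ par ≤ 1 := by
  have hc : Measurable fun q : ℝ × ℝ => condDens Q i p q.2 q.1 :=
    (measurable_condDens i p).comp measurable_swap
  rw [lintegral_matchedGaussian_pair hθ hM hpi (F := fun a b => condDens Q i p b a /
    (gaussianPDF 0 1 b * ENNReal.ofReal (corrDensity (pairCoef θ par p i) a b)))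
    (hc.div (by fun_prop : Measurable fun q : ℝ × ℝ => gaussianPDF 0 1 q.2 *
      ENNReal.ofReal (corrDensity (pairCoef θ par p i) q.1 q.2)))]
  have h1 : ∀ a, ∫⁻ b, condDens Q i p b a / (gaussianPDF 0 1 b *
      ENNReal.ofReal (corrDensity (pairCoef θ par p i) a b)) *
      ENNReal.ofReal (corrDensity (pairCoef θ par p i) a b) ∂stdNormal
      ≤ ∫⁻ b, condDens Q i p b a := by
    intro a
    have hca : Measurable fun b => condDens Q i p b a :=
      hc.comp (measurable_const.prodMk measurable_id)
    rw [lintegral_stdNormal (by fun_prop)]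
    refine lintegral_mono fun b => ?_
    refine le_of_eq_of_le ?_ (ENNReal.mul_div_le (a := gaussianPDF 0 1 b *
      ENNReal.ofReal (corrDensity (pairCoef θ par p i) a b)))
    ring
  have h2 : ∀ᵐ a ∂stdNormal, ∫⁻ b, condDens Q i p b a ≤ 1 := by
    filter_upwards [stdNormal_absolutelyContinuous.ae_le (lintegral_pdf_pair_le hQ p i)] with a ha
    have : ∫⁻ b, condDens Q i p b a
        = (∫⁻ b, pdf (fun x : Fin n → ℝ => (x p, x i)) Q volume (a, b)) / dens Q p a := by
      simp_rw [condDens, div_eq_mul_inv]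
      exact lintegral_mul_const _
        ((measurable_pdf _ _ _).comp (measurable_const.prodMk measurable_id))
    rw [this]
    exact ENNReal.div_le_of_le_mul (by simpa using ha)
  calc _ ≤ ∫⁻ _, 1 ∂stdNormal := by
        refine lintegral_mono_ae ?_
        filter_upwards [h2] with a ha using (h1 a).trans ha
    _ = 1 := by simp

end Ratios

section Divergence

variable {θ : ℝ} {par : Fin n → Option (Fin n)}

lemma map_pair_stdNormalPi {p i : Fin n} (hpi : p ≠ i) :
    (stdNormalPi n).map (fun z => (z p, z i)) = stdNormal.prod stdNormal := by
  refine Measure.ext_of_lintegral _ fun F hF => ?_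
  rw [lintegral_map hF (by fun_prop), lintegral_prod _ hF.aemeasurable, ← matchedGaussian_none 0,
    lintegral_matchedGaussian_pair_of_ne (by norm_num) isMatching_none hpi (by simp) (by simp)
      (F := fun x y => F (x, y)) hF]

lemma integrable_log_edgeDensity (hθ : θ ^ 2 < 1) (hM : IsMatching par) {p i : Fin n}
    (h : par i = some p) :
    Integrable (fun x => Real.log (edgeDensity θ par i x)) (matchedGaussian θ par) := by
  have hm : Measurable fun x => Real.log (edgeDensity θ par i x) := by fun_prop
  have h1 := integrable_log_corrDensity_affine hθ
  rw [← map_pair_stdNormalPi (hM.ne_of_par_eq h)] at h1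
  rw [matchedGaussian, integrable_map_measure hm.aestronglyMeasurable (by fun_prop)]
  refine (h1.comp_measurable (by fun_prop)).congr (.of_forall fun z => ?_)
  simp [edgeDensity, h, couple_some h, couple_none (hM.par_eq_none h)]

lemma integral_log_edgeDensity (hθ : θ ^ 2 < 1) (hM : IsMatching par) {p i : Fin n}
    (h : par i = some p) :
    ∫ x, Real.log (edgeDensity θ par i x) ∂matchedGaussian θ par
      = -(Real.log (1 - θ ^ 2)) / 2 := by
  have hm : Measurable fun x => Real.log (edgeDensity θ par i x) := by fun_prop
  have hm' : Measurable fun q : ℝ × ℝ =>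
      Real.log (corrDensity θ q.1 (θ * q.1 + √(1 - θ ^ 2) * q.2)) := by fun_prop
  rw [← integral_log_corrDensity_affine hθ, ← map_pair_stdNormalPi (hM.ne_of_par_eq h),
    integral_map (by fun_prop) hm'.aestronglyMeasurable, matchedGaussian,
    integral_map (by fun_prop) hm.aestronglyMeasurable]
  refine integral_congr_ae (.of_forall fun z => ?_)
  simp [edgeDensity, h, couple_some h, couple_none (hM.par_eq_none h)]

open Classical in
/-- The log-likelihood ratio of a matched Gaussian against a `T`-structured law is at least the
contribution of the edges that are missing from `T`, up to terms of nonpositive expectation. This is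
`log t ≤ t - 1`, applied to every factor of the density of the `T`-structured law. -/
lemma sum_missing_sub_le_llr (hθ : θ ^ 2 < 1) (hM : IsMatching par)
    {T : SimpleGraph (Fin n)} (hT : T.IsTree) {r : Fin n} {Q : Measure (Fin n → ℝ)}
    [IsProbabilityMeasure Q] (hPQ : matchedGaussian θ par ≪ Q) (hfac : Factorizes T r Q) :
    ∀ᵐ x ∂matchedGaussian θ par,
      ∑ i with i ∈ missingEdges par T, Real.log (edgeDensity θ par i x)
        - ((dens Q r (x r) / gaussianPDF 0 1 (x r)).toReal - 1)
        - ∑ i, ∑ p with IsParent T r p i, ((condDens Q i p (x i) (x p) / (gaussianPDF 0 1 (x i) *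
            ENNReal.ofReal (corrDensity (pairCoef θ par p i) (x p) (x i)))).toReal - 1)
        ≤ llr (matchedGaussian θ par) Q x := by
  have hP : (matchedGaussian θ par) ≪ volume := by
    rw [matchedGaussian_eq_withDensity hθ hM]
    exact withDensity_absolutelyContinuous _ _
  have h1 : (matchedGaussian θ par).rnDeriv volume =ᵐ[volume] fun x =>
      (∏ i, gaussianPDF 0 1 (x i)) * ∏ i, ENNReal.ofReal (edgeDensity θ par i x) := by
    rw [matchedGaussian_eq_withDensity hθ hM]
    exact Measure.rnDeriv_withDensity _ (by fun_prop)
  filter_upwards [hP.ae_le h1, hP.ae_le hfac,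
    hP.ae_le (Measure.rnDeriv_mul_rnDeriv (κ := volume) hPQ)] with x hx1 hx2 hx3
  rw [Pi.mul_apply, hx1, hx2] at hx3
  have hφ : ∀ i, 0 < (gaussianPDF 0 1 (x i)).toReal := fun i =>
    ENNReal.toReal_pos (gaussianPDF_pos _ one_ne_zero _).ne' gaussianPDF_ne_top
  have he : ∀ i, 0 < edgeDensity θ par i x := fun i => edgeDensity_pos hθ par i x
  have hg : ∀ p i, 0 < corrDensity (pairCoef θ par p i) (x p) (x i) := fun p i =>
    corrDensity_pos (pairCoef_sq_lt hθ _ _ _) _ _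
  have hx4 := congrArg ENNReal.toReal hx3
  simp only [ENNReal.toReal_mul, ENNReal.toReal_prod, ENNReal.toReal_ofReal (he _).le] at hx4
  have hpos : 0 < (∏ i, (gaussianPDF 0 1 (x i)).toReal) * ∏ i, edgeDensity θ par i x :=
    mul_pos (Finset.prod_pos fun i _ => hφ i) (Finset.prod_pos fun i _ => he i)
  rw [← hx4] at hpos
  have hne := hpos.ne'
  simp only [ne_eq, mul_eq_zero, not_or, Finset.prod_eq_zero_iff, not_exists, not_and] at hne
  obtain ⟨hD, hd, hc⟩ := hne
  have hd' : 0 < (dens Q r (x r)).toReal := ENNReal.toReal_nonneg.lt_of_ne' hd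
  have hc' : ∀ i p, IsParent T r p i → 0 < (condDens Q i p (x i) (x p)).toReal := fun i p h =>
    ENNReal.toReal_nonneg.lt_of_ne' (hc i (Finset.mem_univ i) p (by simpa using h))
  have hlog := congrArg Real.log hx4
  rw [Real.log_mul hD (mul_ne_zero hd (Finset.prod_ne_zero_iff.2 fun i _ =>
      Finset.prod_ne_zero_iff.2 fun p hp => (hc' i p (by simpa using hp)).ne')),
    Real.log_mul hd (Finset.prod_ne_zero_iff.2 fun i _ =>
      Finset.prod_ne_zero_iff.2 fun p hp => (hc' i p (by simpa using hp)).ne'),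
    Real.log_mul (Finset.prod_ne_zero_iff.2 fun i _ => (hφ i).ne')
      (Finset.prod_ne_zero_iff.2 fun i _ => (he i).ne'),
    Real.log_prod fun i _ => (Finset.prod_ne_zero_iff.2 fun p hp =>
      (hc' i p (by simpa using hp)).ne'),
    Real.log_prod fun i _ => (hφ i).ne', Real.log_prod fun i _ => (he i).ne',
    ← sum_isParent_const hT r fun i => Real.log (gaussianPDF 0 1 (x i)).toReal] at hlog
  have hlogc : ∀ i, Real.log (∏ p with IsParent T r p i, (condDens Q i p (x i) (x p)).toReal)
      = ∑ p with IsParent T r p i, Real.log (condDens Q i p (x i) (x p)).toReal := fun i =>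
    Real.log_prod fun p hp => (hc' i p (by simpa using hp)).ne'
  simp_rw [hlogc] at hlog
  have hroot : Real.log (dens Q r (x r)).toReal - Real.log (gaussianPDF 0 1 (x r)).toReal
      ≤ (dens Q r (x r) / gaussianPDF 0 1 (x r)).toReal - 1 := by
    rw [← Real.log_div hd (hφ r).ne', ENNReal.toReal_div]
    exact Real.log_le_sub_one_of_pos (div_pos hd' (hφ r))
  have hedge : ∑ i, ∑ p with IsParent T r p i, (Real.log (condDens Q i p (x i) (x p)).toReal
      - Real.log (gaussianPDF 0 1 (x i)).toReal
      - Real.log (corrDensity (pairCoef θ par p i) (x p) (x i)))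
      ≤ ∑ i, ∑ p with IsParent T r p i, ((condDens Q i p (x i) (x p) / (gaussianPDF 0 1 (x i) *
            ENNReal.ofReal (corrDensity (pairCoef θ par p i) (x p) (x i)))).toReal - 1) := by
    refine Finset.sum_le_sum fun i _ => Finset.sum_le_sum fun p hp => ?_
    have hcp := hc' i p (by simpa using hp)
    rw [sub_sub, ← Real.log_mul (hφ i).ne' (hg p i).ne', ← Real.log_div hcp.ne'
      (mul_pos (hφ i) (hg p i)).ne', ENNReal.toReal_div, ENNReal.toReal_mul,
      ENNReal.toReal_ofReal (hg p i).le]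
    exact Real.log_le_sub_one_of_pos (div_pos hcp (mul_pos (hφ i) (hg p i)))
  simp only [Finset.sum_sub_distrib] at hedge ⊢
  have hmiss := sum_log_edgeDensity_sub (θ := θ) hM hT r x
  rw [llr]
  linarith

/-- A tree that misses edges of the matching pays the mutual information of each of them. -/
theorem ofReal_le_klDiv (hθ : θ ^ 2 < 1) (hM : IsMatching par)
    {T : SimpleGraph (Fin n)} {Q : Measure (Fin n → ℝ)} [IsProbabilityMeasure Q]
    (hQ : IsTreeStructuredBy T Q) :
    ENNReal.ofReal ((missingEdges par T).ncard * (-(Real.log (1 - θ ^ 2)) / 2))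
      ≤ InformationTheory.klDiv (matchedGaussian θ par) Q := by
  classical
  by_cases htop : InformationTheory.klDiv (matchedGaussian θ par) Q = ∞
  · simp [htop]
  obtain ⟨hPQ, hint⟩ := InformationTheory.klDiv_ne_top_iff.1 htop
  obtain ⟨r, -, hfac⟩ := hQ.markov
  rw [InformationTheory.klDiv_of_ac_of_integrable hPQ hint]
  refine ENNReal.ofReal_le_ofReal ?_
  simp only [probReal_univ, add_sub_cancel_right]
  have hratio : ∀ {R : (Fin n → ℝ) → ℝ≥0∞}, Measurable R →
      ∫⁻ x, R x ∂matchedGaussian θ par ≤ 1 →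
      Integrable (fun x => (R x).toReal - 1) (matchedGaussian θ par) ∧
        ∫ x, ((R x).toReal - 1) ∂matchedGaussian θ par ≤ 0 := by
    intro R hR hR1
    have hne : ∫⁻ x, R x ∂matchedGaussian θ par ≠ ∞ := ne_top_of_le_ne_top ENNReal.one_ne_top hR1
    have hI := integrable_toReal_of_lintegral_ne_top hR.aemeasurable hne
    refine ⟨hI.sub (integrable_const _), ?_⟩
    rw [integral_sub hI (integrable_const _), integral_toReal hR.aemeasurable
      (ae_lt_top hR hne), integral_const]
    have := ENNReal.toReal_mono ENNReal.one_ne_top hR1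
    simpa using this
  have hroot := hratio (R := fun x => dens Q r (x r) / gaussianPDF 0 1 (x r)) (by fun_prop)
    (lintegral_rootRatio_le_one hθ hM r)
  have hedge : ∀ i p, IsParent T r p i → _ := fun i p hp =>
    hratio (R := fun x => condDens Q i p (x i) (x p) / (gaussianPDF 0 1 (x i) *
      ENNReal.ofReal (corrDensity (pairCoef θ par p i) (x p) (x i))))
      (((measurable_condDens i p).comp (by fun_prop : Measurable fun x : Fin n → ℝ =>
        (x i, x p))).div (by fun_prop))
      (lintegral_edgeRatio_le_one hθ hM hQ.hasDensity hp.ne)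
  have hmiss : ∀ i ∈ Finset.univ.filter (· ∈ missingEdges par T),
      Integrable (fun x => Real.log (edgeDensity θ par i x)) (matchedGaussian θ par) ∧
        ∫ x, Real.log (edgeDensity θ par i x) ∂matchedGaussian θ par
          = -(Real.log (1 - θ ^ 2)) / 2 := by
    intro i hi
    obtain ⟨p, hp, -⟩ := (Finset.mem_filter.1 hi).2
    exact ⟨integrable_log_edgeDensity hθ hM hp, integral_log_edgeDensity hθ hM hp⟩
  have hI1 := integrable_finsetSum (Finset.univ.filter (· ∈ missingEdges par T))
    fun i hi => (hmiss i hi).1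
  have hI2 := integrable_finsetSum Finset.univ fun i (_ : i ∈ Finset.univ) =>
    integrable_finsetSum (Finset.univ.filter fun p => IsParent T r p i)
      fun p hp => (hedge i p (by simpa using hp)).1
  have hle := integral_mono_ae ((hI1.sub hroot.1).sub hI2) hint
    (sum_missing_sub_le_llr hθ hM hQ.isTree hPQ hfac)
  refine le_trans ?_ hle
  have e1 := integral_sub (hI1.sub hroot.1) hI2
  have e2 := integral_sub hI1 hroot.1
  simp only [Pi.sub_apply] at e1 e2 ⊢
  rw [e1, e2, integral_finsetSum _ fun i hi => (hmiss i hi).1,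
    Finset.sum_congr rfl fun i hi => (hmiss i hi).2, integral_finsetSum _ fun i _ =>
    integrable_finsetSum (Finset.univ.filter fun p => IsParent T r p i)
      fun p hp => (hedge i p (by simpa using hp)).1]
  have hsum : ∑ i, ∫ x, ∑ p with IsParent T r p i, ((condDens Q i p (x i) (x p) /
      (gaussianPDF 0 1 (x i) * ENNReal.ofReal (corrDensity (pairCoef θ par p i)
        (x p) (x i)))).toReal - 1) ∂matchedGaussian θ par ≤ 0 := by
    refine Finset.sum_nonpos fun i _ => ?_
    rw [integral_finsetSum _ fun p hp => (hedge i p (by simpa using hp)).1]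
    exact Finset.sum_nonpos fun p hp => (hedge i p (by simpa using hp)).2
  have hcard : (missingEdges par T).ncard
      = (Finset.univ.filter (· ∈ missingEdges par T)).card := by
    rw [← Set.ncard_coe_finset]
    simp
  rw [Finset.sum_const, nsmul_eq_mul, hcard]
  have := hroot.2
  linarith

lemma IsApproxTree.ncard_missingEdges_le (hθ : θ ^ 2 < 1) (hM : IsMatching par) {r : Fin n}
    (hr : par r = none) {η : ℝ} (hη : 0 ≤ η) {T : SimpleGraph (Fin n)}
    (h : IsApproxTree η (matchedGaussian θ par) T) :
    (missingEdges par T).ncard * (-(Real.log (1 - θ ^ 2)) / 2) ≤ η := by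
  obtain ⟨-, Q, hQ, hTQ, hle⟩ := h
  rw [optDiv_matchedGaussian hθ hM hr, add_zero] at hle
  exact (ENNReal.ofReal_le_ofReal_iff hη).1 ((ofReal_le_klDiv hθ hM hTQ).trans hle)

end Divergence

/-! ### Indistinguishability from few samples -/

/-- If a likelihood ratio `G` has second moment at most `1 + κ`, then passing from `μ` to `G • μ`
lowers the expectation of a `[0, 1]`-valued function by at most `√κ`, here with `κ = 1 / 400`. -/
lemma integral_sub_le_integral_mul {α : Type*} [MeasurableSpace α] {μ : Measure α}
    [IsProbabilityMeasure μ] {G f : α → ℝ} (hG : Measurable G) (hG0 : ∀ x, 0 ≤ G x)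
    (hG1 : ∫⁻ x, ENNReal.ofReal (G x) ∂μ = 1)
    (hG2 : ∫⁻ x, ENNReal.ofReal (G x ^ 2) ∂μ ≤ ENNReal.ofReal (401 / 400))
    (hf : Measurable f) (hf0 : ∀ x, 0 ≤ f x) (hf1 : ∀ x, f x ≤ 1) :
    ∫ x, f x ∂μ - 1 / 20 ≤ ∫ x, f x * G x ∂μ := by
  have hfb : ∀ x, ‖f x‖ ≤ 1 := fun x => by
    rw [Real.norm_of_nonneg (hf0 x)]
    exact hf1 x
  have hIG : Integrable G μ :=
    (lintegral_ofReal_ne_top_iff_integrable hG.aestronglyMeasurable (.of_forall hG0)).1 (by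
      rw [hG1]; exact ENNReal.one_ne_top)
  have hIG2 : Integrable (fun x => G x ^ 2) μ :=
    (lintegral_ofReal_ne_top_iff_integrable (hG.pow_const 2).aestronglyMeasurable
      (.of_forall fun x => sq_nonneg _)).1 (ne_top_of_le_ne_top ENNReal.ofReal_ne_top hG2)
  have hIf : Integrable f μ := .of_bound hf.aestronglyMeasurable 1 (.of_forall hfb)
  have hIfG : Integrable (fun x => f x * G x) μ :=
    hIG.bdd_mul hf.aestronglyMeasurable (.of_forall hfb)
  have h1 : ∫ x, G x ∂μ = 1 := by
    rw [integral_eq_lintegral_of_nonneg_ae (.of_forall hG0) hG.aestronglyMeasurable, hG1]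
    simp
  have h2 : ∫ x, G x ^ 2 ∂μ ≤ 401 / 400 := by
    rw [integral_eq_lintegral_of_nonneg_ae (.of_forall fun x => sq_nonneg _)
      (hG.pow_const 2).aestronglyMeasurable]
    refine (ENNReal.toReal_mono ENNReal.ofReal_ne_top hG2).trans ?_
    rw [ENNReal.toReal_ofReal (by norm_num)]
  -- The bound `|1 - G| ≤ t / 2 + (1 - G) ^ 2 / (2 * t)` with the optimal `t = √κ`.
  have hle : ∀ x, f x ≤ f x * G x + (1 / 40 + 10 * (1 - 2 * G x + G x ^ 2)) := by
    intro x
    have h3 : 1 - G x ≤ 1 / 40 + 10 * (1 - 2 * G x + G x ^ 2) := by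
      nlinarith [sq_nonneg (1 - G x - 1 / 20)]
    have h4 : 0 ≤ 1 / 40 + 10 * (1 - 2 * G x + G x ^ 2) := by
      nlinarith [sq_nonneg (1 - G x)]
    nlinarith [mul_le_mul_of_nonneg_left h3 (hf0 x), mul_nonneg (sub_nonneg.2 (hf1 x)) h4]
  have hI2 : Integrable (fun x => 1 - 2 * G x) μ := (integrable_const _).sub (hIG.const_mul 2)
  have hI3 : Integrable (fun x => 1 - 2 * G x + G x ^ 2) μ := hI2.add hIG2
  have hI4 : Integrable (fun x => 1 / 40 + 10 * (1 - 2 * G x + G x ^ 2)) μ :=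
    (integrable_const _).add (hI3.const_mul 10)
  have hint := integral_mono hIf (hIfG.add hI4) hle
  have e1 := integral_add hIfG hI4
  have e2 := integral_add (integrable_const (1 / 40 : ℝ)) (hI3.const_mul 10)
  have e3 := integral_add hI2 hIG2
  have e4 := integral_sub (integrable_const (1 : ℝ)) (hIG.const_mul 2)
  rw [integral_const_mul] at e2 e4
  simp only [Pi.add_apply, integral_const, probReal_univ, smul_eq_mul, one_mul, mul_one] at *
  linarith

instance isProbabilityMeasure_outputLaw {m : ℕ} (A : Algorithm n m) [IsMarkovKernel A]
    (P : Measure (Fin n → ℝ)) [IsProbabilityMeasure P] : IsProbabilityMeasure (outputLaw A P) := by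
  unfold outputLaw
  infer_instance

lemma outputLaw_real {m : ℕ} (A : Algorithm n m) [IsMarkovKernel A] (P : Measure (Fin n → ℝ))
    [IsProbabilityMeasure P] (S : Set (SimpleGraph (Fin n))) :
    (outputLaw A P).real S = ∫ x, (A x).real S ∂Measure.pi fun _ : Fin m => P := by
  have hS : MeasurableSet S := MeasurableSpace.measurableSet_top
  rw [Measure.real, outputLaw, Measure.bind_apply hS A.measurable.aemeasurable]
  exact (integral_toReal (A.measurable_coe hS).aemeasurable
    (.of_forall fun x => measure_lt_top _ _)).symm

/-- With few samples, one edge of the matching hardly influences the output of an algorithm. -/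
lemma outputLaw_sub_le {θ : ℝ} (hθ : θ ^ 2 < 1) {par : Fin n → Option (Fin n)}
    (hM : IsMatching par) {b a : Fin n} (h : par b = some a) {m : ℕ}
    (hm : ((1 - θ ^ 2)⁻¹) ^ m ≤ 401 / 400) (A : Algorithm n m) [IsMarkovKernel A]
    (S : Set (SimpleGraph (Fin n))) :
    (outputLaw A (matchedGaussian θ (Function.update par b none))).real S - 1 / 20
      ≤ (outputLaw A (matchedGaussian θ par)).real S := by
  have hS : MeasurableSet S := MeasurableSpace.measurableSet_top
  have hM' := hM.update_none b
  set P' := matchedGaussian θ (Function.update par b none) with hP'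
  have hab := hM.ne_of_par_eq h
  have hpair : ∀ {F : ℝ → ℝ → ℝ≥0∞}, Measurable F.uncurry →
      ∫⁻ x, F (x a) (x b) ∂P' = ∫⁻ x, ∫⁻ y, F x y ∂stdNormal ∂stdNormal := fun {F} hF =>
    lintegral_matchedGaussian_pair_of_ne hθ hM' hab (by simp)
      (by simp [Function.update_of_ne hab, hM.par_eq_none h]) hF
  have hg1 : ∫⁻ x, ENNReal.ofReal (corrDensity θ (x a) (x b)) ∂P' = 1 := by
    rw [hpair (F := fun x y => ENNReal.ofReal (corrDensity θ x y)) (by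
      change Measurable fun q : ℝ × ℝ => ENNReal.ofReal (corrDensity θ q.1 q.2); fun_prop)]
    simp [lintegral_corrDensity_right hθ]
  have hg2 : ∫⁻ x, ENNReal.ofReal (corrDensity θ (x a) (x b) ^ 2) ∂P'
      = ENNReal.ofReal (1 - θ ^ 2)⁻¹ := by
    rw [hpair (F := fun x y => ENNReal.ofReal (corrDensity θ x y ^ 2)) (by
      change Measurable fun q : ℝ × ℝ => ENNReal.ofReal (corrDensity θ q.1 q.2 ^ 2); fun_prop)]
    exact lintegral_corrDensity_sq hθ
  have hP : matchedGaussian θ par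
      = P'.withDensity fun x => ENNReal.ofReal (corrDensity θ (x a) (x b)) :=
    matchedGaussian_step hθ hM h
  have hprob : IsProbabilityMeasure
      (P'.withDensity fun x => ENNReal.ofReal (corrDensity θ (x a) (x b))) := by
    rw [← hP]; infer_instance
  set G : (Fin m → Fin n → ℝ) → ℝ := fun X => ∏ s, corrDensity θ (X s a) (X s b) with hG
  have hc0 : ∀ x y, 0 ≤ corrDensity θ x y := fun x y => (corrDensity_pos hθ x y).le
  have hG0 : ∀ X, 0 ≤ G X := fun X => Finset.prod_nonneg fun s _ => hc0 _ _
  have hGm : Measurable G := by fun_prop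
  have hpi : Measure.pi (fun _ : Fin m => matchedGaussian θ par)
      = (Measure.pi fun _ : Fin m => P').withDensity fun X => ENNReal.ofReal (G X) := by
    simp_rw [hP]
    rw [pi_withDensity (f := fun _ (x : Fin n → ℝ) =>
      ENNReal.ofReal (corrDensity θ (x a) (x b)))
      fun _ => by fun_prop]
    simp_rw [hG, ENNReal.ofReal_prod_of_nonneg fun s (_ : s ∈ Finset.univ) => hc0 _ _]
  have hG1 : ∫⁻ X, ENNReal.ofReal (G X) ∂Measure.pi (fun _ : Fin m => P') = 1 := by
    simp_rw [hG, ENNReal.ofReal_prod_of_nonneg fun s (_ : s ∈ Finset.univ) => hc0 _ _]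
    rw [lintegral_fin_prod_eq_prod (f := fun _ (x : Fin n → ℝ) =>
      ENNReal.ofReal (corrDensity θ (x a) (x b)))
      fun _ => by fun_prop]
    simp [hg1]
  have hG2 : ∫⁻ X, ENNReal.ofReal (G X ^ 2) ∂Measure.pi (fun _ : Fin m => P')
      ≤ ENNReal.ofReal (401 / 400) := by
    simp_rw [hG, ← Finset.prod_pow,
      ENNReal.ofReal_prod_of_nonneg fun s (_ : s ∈ Finset.univ) => sq_nonneg (corrDensity θ _ _)]
    rw [lintegral_fin_prod_eq_prod
      (f := fun _ (x : Fin n → ℝ) => ENNReal.ofReal (corrDensity θ (x a) (x b) ^ 2))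
      fun _ => by fun_prop]
    simp only [hg2, Finset.prod_const, Finset.card_univ, Fintype.card_fin]
    rw [← ENNReal.ofReal_pow (by rw [inv_nonneg]; linarith)]
    exact ENNReal.ofReal_le_ofReal hm
  rw [outputLaw_real, outputLaw_real, hpi,
    integral_withDensity_eq_integral_toReal_smul (by fun_prop)
      (.of_forall fun X => ENNReal.ofReal_lt_top)]
  refine (integral_sub_le_integral_mul hGm hG0 hG1 hG2 (A.measurable_coe hS).ennreal_toReal
    (fun X => measureReal_nonneg) fun X => measureReal_le_one).trans_eq ?_
  refine integral_congr_ae (.of_forall fun X => ?_)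
  simp only [ENNReal.toReal_ofReal (hG0 X), smul_eq_mul, mul_comm]
  rfl

/-! ### Blocks of three vertices and the averaging argument -/

/-- The vertex `j` of the block `k`, when the vertices are cut into blocks of three. -/
def blockVertex (k : Fin (n / 3)) (j : Fin 3) : Fin n := ⟨3 * k + j, by omega⟩

lemma blockVertex_inj {k k' : Fin (n / 3)} {j j' : Fin 3} :
    blockVertex k j = blockVertex k' j' ↔ k = k' ∧ j = j' := by
  simp only [blockVertex, Fin.ext_iff]
  omega

/-- The first vertex of an edge of the triangle on `{0, 1, 2}`. -/
def edgeFst : Fin 3 → Fin 3 := ![0, 0, 1]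

/-- The second vertex of an edge of the triangle on `{0, 1, 2}`. -/
def edgeSnd : Fin 3 → Fin 3 := ![1, 2, 2]

lemma edgeFst_ne_edgeSnd (e : Fin 3) : edgeFst e ≠ edgeSnd e := by
  revert e; decide

lemma edgeSnd_ne_zero (e : Fin 3) : edgeSnd e ≠ 0 := by
  revert e; decide

open Classical in
/-- The matching that consists of one chosen edge, or none, in each block. -/
noncomputable def blockMatching (h : Fin (n / 3) → Option (Fin 3)) (i : Fin n) : Option (Fin n) :=
  if H : ∃ q : Fin (n / 3) × Fin 3, h q.1 = some q.2 ∧ i = blockVertex q.1 (edgeSnd q.2) then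
    some (blockVertex H.choose.1 (edgeFst H.choose.2))
  else none

lemma blockMatching_eq_some_iff {h : Fin (n / 3) → Option (Fin 3)} {i a : Fin n} :
    blockMatching h i = some a ↔
      ∃ k e, h k = some e ∧ i = blockVertex k (edgeSnd e) ∧ a = blockVertex k (edgeFst e) := by
  unfold blockMatching
  split_ifs with H
  · obtain ⟨h1, h2⟩ := H.choose_spec
    constructor
    · intro ha
      exact ⟨_, _, h1, h2, (Option.some.inj ha).symm⟩
    · rintro ⟨k, e, hk, hi, rfl⟩
      have hk' : H.choose.1 = k := (blockVertex_inj.1 (h2.symm.trans hi)).1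
      rw [hk', hk] at h1
      rw [hk', Option.some.inj h1]
  · refine ⟨fun h => by simp at h, ?_⟩
    rintro ⟨k, e, hk, hi, -⟩
    exact absurd ⟨(k, e), hk, hi⟩ H

lemma blockMatching_eq_none_iff {h : Fin (n / 3) → Option (Fin 3)} {i : Fin n} :
    blockMatching h i = none ↔ ∀ k e, h k = some e → i ≠ blockVertex k (edgeSnd e) := by
  rw [Option.eq_none_iff_forall_ne_some]
  constructor
  · exact fun H k e hk hi => H _ (blockMatching_eq_some_iff.2 ⟨k, e, hk, hi, rfl⟩)
  · intro H a ha
    obtain ⟨k, e, hk, hi, -⟩ := blockMatching_eq_some_iff.1 ha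
    exact H k e hk hi

lemma isMatching_blockMatching (h : Fin (n / 3) → Option (Fin 3)) :
    IsMatching (blockMatching h) := by
  constructor
  · intro b a hab
    obtain ⟨k, e, hk, -, rfl⟩ := blockMatching_eq_some_iff.1 hab
    refine blockMatching_eq_none_iff.2 fun k' e' hk' heq => ?_
    obtain ⟨rfl, h2⟩ := blockVertex_inj.1 heq
    rw [hk] at hk'
    exact edgeFst_ne_edgeSnd e (Option.some.inj hk' ▸ h2)
  · intro b b' a hb hb'
    obtain ⟨k, e, hk, rfl, rfl⟩ := blockMatching_eq_some_iff.1 hb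
    obtain ⟨k', e', hk', rfl, heq⟩ := blockMatching_eq_some_iff.1 hb'
    obtain ⟨rfl, -⟩ := blockVertex_inj.1 heq
    rw [hk] at hk'
    rw [Option.some.inj hk']

lemma blockMatching_zero (hn : 3 ≤ n) (h : Fin (n / 3) → Option (Fin 3)) :
    blockMatching h ⟨0, by omega⟩ = none := by
  refine blockMatching_eq_none_iff.2 fun k e _ heq => edgeSnd_ne_zero e ?_
  have := congrArg Fin.val heq
  simp only [blockVertex] at this
  ext
  simp
  omega

lemma blockMatching_update_none {h : Fin (n / 3) → Option (Fin 3)} {k : Fin (n / 3)} {e : Fin 3}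
    (hk : h k = some e) : blockMatching (Function.update h k none)
      = Function.update (blockMatching h) (blockVertex k (edgeSnd e)) none := by
  ext i a
  rw [blockMatching_eq_some_iff]
  by_cases hi : i = blockVertex k (edgeSnd e)
  · subst hi
    simp only [Function.update_self, reduceCtorEq, iff_false]
    rintro ⟨k', e', hk', heq, -⟩
    obtain ⟨rfl, -⟩ := blockVertex_inj.1 heq
    simp at hk'
  · rw [Function.update_of_ne hi, blockMatching_eq_some_iff]
    refine exists_congr fun k' => exists_congr fun e' => ?_
    by_cases hkk : k' = k
    · subst hkk
      simp only [Function.update_self, reduceCtorEq, false_and, false_iff]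
      rintro ⟨h1, h2, -⟩
      rw [hk] at h1
      exact hi (Option.some.inj h1 ▸ h2)
    · rw [Function.update_of_ne hkk]

/-- A tree cannot contain all three edges of a block. -/
lemma exists_not_adj_of_isTree {T : SimpleGraph (Fin n)} (hT : T.IsTree) (k : Fin (n / 3)) :
    ∃ e, ¬ T.Adj (blockVertex k (edgeFst e)) (blockVertex k (edgeSnd e)) := by
  by_contra! H
  have h0 : T.Adj (blockVertex k 0) (blockVertex k 1) := H 0
  have h1 : T.Adj (blockVertex k 0) (blockVertex k 2) := H 1
  have h2 : T.Adj (blockVertex k 1) (blockVertex k 2) := H 2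
  exact hT.dist_ne_of_adj (blockVertex k 0) h2
    ((SimpleGraph.dist_eq_one_iff_adj.2 h0).trans (SimpleGraph.dist_eq_one_iff_adj.2 h1).symm)

/-- The trees that miss the edge `e` of the block `k`. -/
def missSet (k : Fin (n / 3)) (e : Fin 3) : Set (SimpleGraph (Fin n)) :=
  {T | T.IsTree ∧ ¬ T.Adj (blockVertex k (edgeFst e)) (blockVertex k (edgeSnd e))}

open Classical in
lemma card_miss_le_ncard (e : Fin (n / 3) → Fin 3) (T : SimpleGraph (Fin n)) :
    (Finset.univ.filter fun k => T ∈ missSet k (e k)).card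
      ≤ (missingEdges (blockMatching fun k => some (e k)) T).ncard := by
  rw [← Set.ncard_coe_finset]
  refine Set.ncard_le_ncard_of_injOn (fun k => blockVertex k (edgeSnd (e k))) ?_ ?_
    (Set.toFinite _)
  · intro k hk
    exact ⟨_, blockMatching_eq_some_iff.2 ⟨k, e k, rfl, rfl, rfl⟩, (Finset.mem_filter.1 hk).2.2⟩
  · intro k _ k' _ h
    exact (blockVertex_inj.1 h).1

/-- The Gaussian law whose correlated pairs are the edges chosen by `h`. -/
noncomputable abbrev blockGaussian (θ : ℝ) (h : Fin (n / 3) → Option (Fin 3)) :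
    Measure (Fin n → ℝ) :=
  matchedGaussian θ (blockMatching h)

lemma LearnsTrees.real_ge {m : ℕ} {A : Algorithm n m} [IsMarkovKernel A] {η : ℝ}
    (hA : LearnsTrees A η) (hn : 3 ≤ n) {θ : ℝ} (hθ : θ ^ 2 < 1)
    (h : Fin (n / 3) → Option (Fin 3)) :
    9 / 10 ≤ (outputLaw A (blockGaussian θ h)).real {T | IsApproxTree η (blockGaussian θ h) T} := by
  have h1 := hA (blockGaussian θ h) (integral_matchedGaussian_eval θ _)
    ⟨_, isTreeStructuredBy_matchedGaussian hθ (isMatching_blockMatching h)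
      (blockMatching_zero hn h)⟩
  have h2 := ENNReal.toReal_mono (measure_ne_top _ _) h1
  refine le_of_eq_of_le ?_ h2
  rw [ENNReal.toReal_div]
  simp

/-- An accurate algorithm misses few edges on average over the blocks. -/
lemma sum_real_missSet_le {m : ℕ} {A : Algorithm n m} [IsMarkovKernel A] {η : ℝ} (hη : 0 ≤ η)
    (hA : LearnsTrees A η) (hn : 3 ≤ n) {θ : ℝ} (hθ : θ ^ 2 < 1)
    (hηθ : η ≤ ((n / 3 : ℕ) : ℝ) / 10 * (θ ^ 2 / 2)) (hθ0 : 0 < θ ^ 2) (e : Fin (n / 3) → Fin 3) :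
    ∑ k, (outputLaw A (blockGaussian θ fun k => some (e k))).real (missSet k (e k))
      ≤ ((n / 3 : ℕ) : ℝ) / 5 := by
  classical
  set P := blockGaussian θ fun k => some (e k) with hP
  set L := outputLaw A P with hL
  set S := {T | IsApproxTree η P T} with hS
  have hmeas : ∀ s : Set (SimpleGraph (Fin n)), MeasurableSet s := fun s =>
    MeasurableSpace.measurableSet_top
  have hlog : θ ^ 2 / 2 ≤ -(Real.log (1 - θ ^ 2)) / 2 := by
    have := Real.log_le_sub_one_of_pos (show 0 < 1 - θ ^ 2 by linarith)
    linarith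
  have hpt : ∀ T, ∑ k, (missSet k (e k)).indicator (1 : SimpleGraph (Fin n) → ℝ) T
      ≤ ((n / 3 : ℕ) : ℝ) / 10 + ((n / 3 : ℕ) : ℝ) * Sᶜ.indicator 1 T := by
    intro T
    have h1 : ∑ k, (missSet k (e k)).indicator (1 : SimpleGraph (Fin n) → ℝ) T
        = (Finset.univ.filter fun k => T ∈ missSet k (e k)).card := by
      simp [Set.indicator_apply]
    rw [h1]
    by_cases hT : T ∈ S
    · have h2 := IsApproxTree.ncard_missingEdges_le hθ (isMatching_blockMatching _)
        (blockMatching_zero hn _) hη hT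
      have h3 : ((Finset.univ.filter fun k => T ∈ missSet k (e k)).card : ℝ)
          ≤ (missingEdges (blockMatching fun k => some (e k)) T).ncard := by
        exact_mod_cast card_miss_le_ncard e T
      have h4 : ((Finset.univ.filter fun k => T ∈ missSet k (e k)).card : ℝ) * (θ ^ 2 / 2)
          ≤ ((n / 3 : ℕ) : ℝ) / 10 * (θ ^ 2 / 2) :=
        (mul_le_mul h3 hlog (by positivity) (by positivity)).trans (h2.trans hηθ)
      have h5 := le_of_mul_le_mul_right h4 (by positivity)
      simpa [hT] using h5
    · have h2 : ((Finset.univ.filter fun k => T ∈ missSet k (e k)).card : ℝ)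
          ≤ ((n / 3 : ℕ) : ℝ) := by
        exact_mod_cast (Finset.card_le_univ _).trans_eq (Fintype.card_fin _)
      have h3 : Sᶜ.indicator (1 : SimpleGraph (Fin n) → ℝ) T = 1 := by simp [hT]
      rw [h3, mul_one]
      have : (0 : ℝ) ≤ ((n / 3 : ℕ) : ℝ) / 10 := by positivity
      linarith
  have hind : ∀ s : Set (SimpleGraph (Fin n)),
      Integrable (s.indicator (1 : SimpleGraph (Fin n) → ℝ)) L := fun s =>
    (integrable_const (1 : ℝ)).indicator (hmeas s)
  have hI := integral_mono (integrable_finsetSum Finset.univ fun k _ => hind (missSet k (e k)))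
    ((integrable_const (((n / 3 : ℕ) : ℝ) / 10)).add ((hind Sᶜ).const_mul ((n / 3 : ℕ) : ℝ))) hpt
  have e1 := integral_add (integrable_const (μ := L) (((n / 3 : ℕ) : ℝ) / 10))
    ((hind Sᶜ).const_mul ((n / 3 : ℕ) : ℝ))
  simp only [Pi.add_apply] at hI e1
  rw [e1, integral_finsetSum _ fun k _ => hind _, integral_const_mul,
    integral_indicator_one (hmeas _), integral_const, probReal_univ, one_smul,
    probReal_compl_eq_one_sub (hmeas S)] at hI
  simp_rw [integral_indicator_one (hmeas _)] at hI
  have hge := hA.real_ge hn hθ fun k => some (e k)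
  have hK : (0 : ℝ) ≤ ((n / 3 : ℕ) : ℝ) := by positivity
  have := mul_le_mul_of_nonneg_left hge hK
  refine hI.trans ?_
  linarith

/-- If the samples carry no information about the edge of the block `k`, then the output tree, which
contains at most two of the three candidate edges, is often wrong. -/
lemma le_sum_real_missSet {m : ℕ} {A : Algorithm n m} [IsMarkovKernel A] {η : ℝ}
    (hA : LearnsTrees A η) (hn : 3 ≤ n) {θ : ℝ} (hθ : θ ^ 2 < 1)
    (hm : ((1 - θ ^ 2)⁻¹) ^ m ≤ 401 / 400) (e : Fin (n / 3) → Fin 3) (k : Fin (n / 3)) :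
    3 / 4 ≤ ∑ j, (outputLaw A (blockGaussian θ fun k' =>
      some (Function.update e k j k'))).real (missSet k j) := by
  set h₀ : Fin (n / 3) → Option (Fin 3) := Function.update (fun k' => some (e k')) k none
  set L₀ := outputLaw A (blockGaussian θ h₀)
  have h1 : ∀ j, L₀.real (missSet k j) - 1 / 20 ≤ (outputLaw A (blockGaussian θ fun k' =>
      some (Function.update e k j k'))).real (missSet k j) := by
    intro j
    have hk : (fun k' => some (Function.update e k j k')) k = some j := by simp
    have hupd : Function.update (fun k' => some (Function.update e k j k')) k none = h₀ := by
      ext1 k'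
      by_cases hk' : k' = k
      · subst hk'; simp [h₀]
      · simp [h₀, hk']
    have := outputLaw_sub_le hθ
      (isMatching_blockMatching fun k' => some (Function.update e k j k'))
      (blockMatching_eq_some_iff.2 ⟨k, j, hk, rfl, rfl⟩) hm A (missSet k j)
    rwa [← blockMatching_update_none hk, hupd] at this
  have h2 : 9 / 10 ≤ ∑ j, L₀.real (missSet k j) := by
    refine (hA.real_ge hn hθ h₀).trans ?_
    refine le_trans (measureReal_mono ?_) (measureReal_iUnion_fintype_le _)
    intro T hT
    obtain ⟨j, hj⟩ := exists_not_adj_of_isTree hT.1 k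
    exact Set.mem_iUnion.2 ⟨j, hT.1, hj⟩
  have h3 := Finset.sum_le_sum fun j (_ : j ∈ Finset.univ) => h1 j
  rw [Finset.sum_sub_distrib] at h3
  simp only [Finset.sum_const, Finset.card_univ, Fintype.card_fin, nsmul_eq_mul] at h3
  norm_num at h3
  linarith

/-- Resampling one coordinate of a uniformly random word does not change averages. -/
lemma sum_sum_update {ι κ : Type*} [Fintype ι] [DecidableEq ι] [Fintype κ] [DecidableEq κ]
    (i : ι) (F : (ι → κ) → ℝ) :
    ∑ e : ι → κ, ∑ j, F (Function.update e i j) = Fintype.card κ * ∑ e, F e := by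
  rw [← Fintype.sum_prod_type' fun e j => F (Function.update e i j)]
  have hinv : Function.Involutive
      fun q : (ι → κ) × κ => (Function.update q.1 i q.2, q.1 i) := fun q => by simp
  rw [← hinv.bijective.sum_comp fun q : (ι → κ) × κ => F (Function.update q.1 i q.2)]
  simp [Fintype.sum_prod_type, Finset.mul_sum]

/-- With few samples, no algorithm learns all block models. -/
theorem not_learnsTrees {m : ℕ} {A : Algorithm n m} [IsMarkovKernel A] {η : ℝ} (hη : 0 ≤ η)
    (hn : 3 ≤ n) {θ : ℝ} (hθ : θ ^ 2 < 1) (hθ0 : 0 < θ ^ 2)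
    (hηθ : η ≤ ((n / 3 : ℕ) : ℝ) / 10 * (θ ^ 2 / 2)) (hm : ((1 - θ ^ 2)⁻¹) ^ m ≤ 401 / 400) :
    ¬ LearnsTrees A η := by
  intro hA
  set F : (Fin (n / 3) → Fin 3) → Fin (n / 3) → ℝ := fun e k =>
    (outputLaw A (blockGaussian θ fun k' => some (e k'))).real (missSet k (e k)) with hF
  have h1 : ∑ e, ∑ k, F e k ≤ ∑ _e : Fin (n / 3) → Fin 3, ((n / 3 : ℕ) : ℝ) / 5 :=
    Finset.sum_le_sum fun e _ => sum_real_missSet_le hη hA hn hθ hηθ hθ0 e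
  have h2 : ∑ k : Fin (n / 3), ∑ _e : Fin (n / 3) → Fin 3, (3 / 4 : ℝ)
      ≤ ∑ k, ∑ e, ∑ j, F (Function.update e k j) k := by
    refine Finset.sum_le_sum fun k _ => Finset.sum_le_sum fun e _ => ?_
    simpa [hF] using le_sum_real_missSet hA hn hθ hm e k
  simp_rw [fun k => sum_sum_update k fun e => F e k] at h2
  rw [← Finset.mul_sum] at h2
  simp only [Finset.sum_const, Finset.card_univ, Fintype.card_fin, nsmul_eq_mul,
    Fintype.card_pi, Finset.prod_const] at h1 h2
  rw [Finset.sum_comm] at h1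
  have hK : (0 : ℝ) < ((n / 3 : ℕ) : ℝ) := by
    have : 0 < n / 3 := by omega
    exact_mod_cast this
  push_cast at h1 h2
  have h3 : (0 : ℝ) < (3 : ℝ) ^ (n / 3) * ((n / 3 : ℕ) : ℝ) := by positivity
  linarith

end GaussianTree

theorem mainTheorem4 :
    ∃ c : ℝ, 0 < c ∧
      ∀ (n : ℕ), 3 ≤ n → ∀ (ε : ℝ), 0 < ε → ε < 1 →
        ∀ (m : ℕ) (A : GaussianTree.Algorithm n m) [ProbabilityTheory.IsMarkovKernel A],
          GaussianTree.LearnsTrees A (ε / 320) → c * ((n : ℝ) / ε) ≤ (m : ℝ) := by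
  refine ⟨1 / 200, by norm_num, fun n hn ε hε hε1 m A _ hA => ?_⟩
  by_contra! hlt
  have hK1 : (1 : ℝ) ≤ ((n / 3 : ℕ) : ℝ) := by
    have : 1 ≤ n / 3 := by omega
    exact_mod_cast this
  have hnK : (n : ℝ) ≤ 5 * ((n / 3 : ℕ) : ℝ) := by
    have : n ≤ 5 * (n / 3) := by omega
    exact_mod_cast this
  have hKpos : (0 : ℝ) < ((n / 3 : ℕ) : ℝ) := by linarith
  -- The correlation is chosen such that one wrong edge in ten costs `ε / 320`.
  obtain ⟨u, hu⟩ : ∃ u : ℝ, u = ε / (16 * ((n / 3 : ℕ) : ℝ)) := ⟨_, rfl⟩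
  have hu0 : 0 < u := by rw [hu]; positivity
  have hu1 : u ≤ 1 / 16 := by
    rw [hu, div_le_div_iff₀ (by positivity) (by norm_num)]
    linarith
  have hθ : √u ^ 2 = u := Real.sq_sqrt hu0.le
  have hmu : m * u ≤ 1 / 640 := by
    calc (m : ℝ) * u ≤ 1 / 200 * (n / ε) * u := mul_le_mul_of_nonneg_right hlt.le hu0.le
      _ = n / (3200 * ((n / 3 : ℕ) : ℝ)) := by rw [hu]; field_simp; norm_num
      _ ≤ 1 / 640 := by
        rw [div_le_div_iff₀ (by positivity) (by norm_num)]
        linarith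
  have hpow : 639 / 640 ≤ (1 - u) ^ m := by
    have := one_add_mul_le_pow (show (-2 : ℝ) ≤ -u by linarith) m
    rw [← sub_eq_add_neg] at this
    linarith
  refine GaussianTree.not_learnsTrees (by positivity) hn (θ := √u) (by rw [hθ]; linarith)
    (by rw [hθ]; exact hu0) (le_of_eq ?_) ?_ hA
  · rw [hθ, hu]
    field_simp
    norm_num
  · rw [hθ, inv_pow, inv_le_comm₀ (by positivity) (by norm_num)]
    linarith
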